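/- Let $d\ge 1$ be an integer and let $\alpha,\beta\ge 0$, $\lambda>0$ be real numbers with $\alpha+\beta+\lambda<d$. For $f:\mathbb R^d\to\mathbb R$ let $$I f(x)=I_{\alpha,\beta,\lambda}f(x)=|x|^{-\beta}\int_{\mathbb R^d}\frac{f(y)\,|y|^{-\alpha}}{|x-y|^{\lambda}}\,dy$$ be the weighted Riesz potential, where $|\cdot|$ is the Euclidean norm, and write $|f|_r$ for the norm of $L_r(\mathbb R^d)$. Put $$p_-=\frac{d}{d-\alpha},\qquad p_+=\frac{d}{d-\alpha-\lambda},\qquad \kappa=\frac{\alpha+\beta+\lambda}{d}.$$ For $p\in(p_-,p_+)$ let $q=q(p)>0$ be given by $1+\frac1q=\frac1p+\frac{\alpha+\beta+\lambda}{d}$, and set $$V(p)=V_{\alpha,\beta,\lambda}(p)=\sup\left\{\frac{|I f|_q}{|f|_p}\;:\; f\in\bigcap_{r\in(p_-,p_+)}L_r(\mathbb R^d),\ f\ne 0\right\}.$$ Then there are constants $C_1,C_2>0$, depending only on $d,\alpha,\beta,\lambda$, such that for every $p\in(p_-,p_+)$ $$\frac{C_1}{[(p-p_-)(p_+-p)]^{\kappa}}\le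 V(p)\le\frac{C_2}{[(p-p_-)(p_+-p)]^{\kappa}}.$$ Moreover, $V(p)$ is the best constant on all of $L_p(\mathbb R^d)$: for every $p\in(p_-,p_+)$ and $f\in L_p(\mathbb R^d)$ the integral defining $I f(x)$ converges absolutely for almost every $x$, $I f\in L_q(\mathbb R^d)$, and $|I f|_q\le V(p)\,|f|_p$. -/

import Mathlib

open MeasureTheory
open scoped ENNReal

noncomputable section

/-- The integrand of the weighted Riesz potential at `x`: `y ↦ f(y) |y|^{-α} / |x - y|^λ`. -/
def rieszIntegrand (d : ℕ) (α lam : ℝ) (f : EuclideanSpace ℝ (Fin d) → ℝ)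
    (x y : EuclideanSpace ℝ (Fin d)) : ℝ :=
  f y * ‖y‖ ^ (-α) / ‖x - y‖ ^ lam

/-- The weighted Riesz potential
`I_{α,β,λ} f(x) = |x|^{-β} ∫ f(y) |y|^{-α} |x - y|^{-λ} dy`. -/
def weightedRiesz (d : ℕ) (α β lam : ℝ) (f : EuclideanSpace ℝ (Fin d) → ℝ)
    (x : EuclideanSpace ℝ (Fin d)) : ℝ :=
  ‖x‖ ^ (-β) * ∫ y, rieszIntegrand d α lam f x y

/-- `κ = (α + β + λ) / d`. -/
def rieszKappa (d : ℕ) (α β lam : ℝ) : ℝ := (α + β + lam) / d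

/-- `p₋ = d / (d - α)`. -/
def pMinus (d : ℕ) (α : ℝ) : ℝ := d / (d - α)

/-- `p₊ = d / (d - α - λ)`. -/
def pPlus (d : ℕ) (α lam : ℝ) : ℝ := d / (d - α - lam)

/-- The set `G(α, β, λ)` of pairs of (positive) exponents `(p, q)` tied by the scaling relation
`1 + 1/q = 1/p + (α + β + λ)/d`. -/
def rieszG (d : ℕ) (α β lam : ℝ) : Set (ℝ × ℝ) :=
  {pq | 0 < pq.1 ∧ 0 < pq.2 ∧ 1 + 1 / pq.2 = 1 / pq.1 + (α + β + lam) / d}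

/-- The space `L(a, b) = ⋂_{r ∈ (a, b)} L_r(ℝ^d)`, as a set of real functions. -/
def interLp (d : ℕ) (a b : ℝ) : Set (EuclideanSpace ℝ (Fin d) → ℝ) :=
  {f | ∀ r ∈ Set.Ioo a b, MemLp f (ENNReal.ofReal r) volume}

/-- The exact value of the constant: the supremum of `|I f|_q / |f|_p` over all `f` in
`L(p₋, p₊)` that are not a.e. zero. -/
def rieszV (d : ℕ) (α β lam p q : ℝ) : ℝ≥0∞ :=
  ⨆ f ∈ {f ∈ interLp d (pMinus d α) (pPlus d α lam) | ¬ f =ᵐ[volume] 0},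
    eLpNorm (weightedRiesz d α β lam f) (ENNReal.ofReal q) volume /
      eLpNorm f (ENNReal.ofReal p) volume

end

/-!
The kernel `K(x, y) = |x|^{-β} |y|^{-α} |x - y|^{-λ}` satisfies restricted weak-type estimates at
both endpoints: since `|y|^{-α} |x - y|^{-λ} ≤ |y|^{-(α+λ)} + |x - y|^{-(α+λ)}` and the integral of
`|y - z|^{-γ}` over `F` is `O(|F|^{1-γ/d})`, the form `∫_G ∫_F K` is at most a constant times either
of `|F|^{1/p₋} |G|^{1-1/q₋}` and `|F|^{1/p₊} |G|^{1-1/q₊}`, where `q₋ = d/(β+λ)` and `q₊ = d/β`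
(`exists_setLIntegral_rieszKernel_le_pMinus`, `exists_setLIntegral_rieszKernel_le_pPlus`).

For `f, g ≥ 0` of norm one in `L^p` and `L^s`, `s = q'`, the layer-cake formula turns `∫ g I f` into
an integral over levels `(a, b)` of these estimates for `F = {f > a}` and `G = {g > b}`. The first
one is used where `b^s ≤ a^p`, the second one elsewhere. In logarithmic coordinates each half is a
convolution form, with an exponential kernel of rate proportional to `δ = |1/p - 1/p_±|`, acting on
powers of two `L^1` functions. Young's inequality with the `L^{1/κ}` norm of that kernel gives
`(κ/δ)^κ` up to a constant (`lintegral_distrib_form_le`); this is where the exponent `κ` comes from.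
Duality then gives the strong bound `exists_eLpNorm_lintegral_rieszKernel_le`, hence convergence of
the integral almost everywhere. Truncation and Fatou's lemma pass from `⋂ L_r` to `L_p`.

The lower bounds come from the critical powers `|y|^{-d/p₋}` on `|y| > 1` and `|y|^{-d/p₊}` on
`|y| < 1`. For these the potential exceeds a pure power by the logarithmic factor
`∫ |y|^{-d} dy ≥ σ/δ` once `|x| > e^{1/δ}`, respectively `|x| < e^{-1/δ}`
(`ofReal_gapMinus_le_rieszV`, `ofReal_gapPlus_le_rieszV`). As the two gaps add up to `λ/d`, only the
smaller one matters, and it is comparable to `(p - p₋)(p₊ - p)`.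
-/

/-! ### Power integrals on the line and polar coordinates -/

open Set in
lemma lintegral_Ioo_zero_rpow {m R : ℝ} (hm : 0 < m) (hR : 0 ≤ R) :
    ∫⁻ r in Ioo 0 R, ENNReal.ofReal (r ^ (m - 1)) = ENNReal.ofReal (R ^ m / m) := by
  have hint : IntervalIntegrable (fun r : ℝ => r ^ (m - 1)) volume 0 R :=
    intervalIntegral.intervalIntegrable_rpow' (by linarith)
  rw [intervalIntegrable_iff_integrableOn_Ioo_of_le hR] at hint
  rw [← ofReal_integral_eq_lintegral_ofReal hint, ← integral_Ioc_eq_integral_Ioo,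
    ← intervalIntegral.integral_of_le hR, integral_rpow (Or.inl (by linarith))]
  · rw [sub_add_cancel, Real.zero_rpow hm.ne', sub_zero]
  · filter_upwards [ae_restrict_mem measurableSet_Ioo] with r hr
    exact Real.rpow_nonneg hr.1.le _

open Set in
lemma lintegral_Ioi_rpow {m R : ℝ} (hm : 0 < m) (hR : 0 < R) :
    ∫⁻ r in Ioi R, ENNReal.ofReal (r ^ (-m - 1)) = ENNReal.ofReal (R ^ (-m) / m) := by
  rw [← ofReal_integral_eq_lintegral_ofReal
    (integrableOn_Ioi_rpow_of_lt (by linarith : -m - 1 < -1) hR),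
    integral_Ioi_rpow_of_lt (by linarith : -m - 1 < -1) hR]
  · congr 1
    rw [sub_add_cancel, neg_div_neg_eq]
  · filter_upwards [ae_restrict_mem measurableSet_Ioi] with r hr
    exact Real.rpow_nonneg (hR.trans hr).le _

open Set in
lemma lintegral_Ioo_inv {a b : ℝ} (ha : 0 < a) (hab : a ≤ b) :
    ∫⁻ r in Ioo a b, ENNReal.ofReal r⁻¹ = ENNReal.ofReal (Real.log (b / a)) := by
  have hint : IntervalIntegrable (fun r : ℝ => r⁻¹) volume a b := by
    apply intervalIntegral.intervalIntegrable_inv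
    · intro x hx
      rw [uIcc_of_le hab] at hx
      exact (ha.trans_le hx.1).ne'
    · exact continuousOn_id
  rw [intervalIntegrable_iff_integrableOn_Ioo_of_le hab] at hint
  rw [← ofReal_integral_eq_lintegral_ofReal hint, ← integral_Ioc_eq_integral_Ioo,
    ← intervalIntegral.integral_of_le hab, integral_inv_of_pos ha (ha.trans_le hab)]
  filter_upwards [ae_restrict_mem measurableSet_Ioo] with r hr
  exact inv_nonneg.2 (ha.trans hr.1).le

open Set Module in
/-- Polar coordinates for the Lebesgue integral of a radial function with values in `ℝ≥0∞`. -/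
lemma lintegral_fun_norm_addHaar {E : Type*} [NormedAddCommGroup E] [NormedSpace ℝ E]
    [FiniteDimensional ℝ E] [Nontrivial E] [MeasurableSpace E] [BorelSpace E] (μ : Measure E)
    [μ.IsAddHaarMeasure] {F : ℝ → ℝ≥0∞} (hF : Measurable F) :
    ∫⁻ x, F ‖x‖ ∂μ = (finrank ℝ E * μ (Metric.ball 0 1)) *
      ∫⁻ r in Ioi (0 : ℝ), ENNReal.ofReal (r ^ (finrank ℝ E - 1)) * F r := by
  have hm : Measurable fun r : Ioi (0 : ℝ) => F r := hF.comp measurable_subtype_coe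
  calc
    ∫⁻ x, F ‖x‖ ∂μ = ∫⁻ x : ({(0)}ᶜ : Set E), F (‖x.1‖) ∂(μ.comap (↑)) := by
      rw [lintegral_subtype_comap (measurableSet_singleton _).compl fun x ↦ F (‖x‖),
        restrict_compl_singleton]
    _ = ∫⁻ x, F x.2 ∂μ.toSphere.prod (.volumeIoiPow (finrank ℝ E - 1)) := by
      simpa using μ.measurePreserving_homeomorphUnitSphereProd.lintegral_comp
        (f := F ∘ Subtype.val ∘ Prod.snd) (hm.comp measurable_snd)
    _ = μ.toSphere univ * ∫⁻ x : Ioi (0 : ℝ), F x ∂.volumeIoiPow (finrank ℝ E - 1) := by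
      have := lintegral_prod_mul (μ := μ.toSphere) (ν := .volumeIoiPow (finrank ℝ E - 1))
        (f := fun _ => 1) (g := fun r : Ioi (0 : ℝ) => F r) aemeasurable_const hm.aemeasurable
      simpa using this
    _ = _ := by
      rw [Measure.toSphere_apply_univ, Measure.volumeIoiPow,
        lintegral_withDensity_eq_lintegral_mul _ (by fun_prop) hm,
        ← lintegral_subtype_comap measurableSet_Ioi]
      rfl

/-! ### Integrals of powers of the norm -/

/-- The surface measure of the unit sphere of `ℝ^d`, written as `d` times the volume of the unit
ball. -/
noncomputable def sphereArea (d : ℕ) : ℝ≥0∞ :=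
  d * volume (Metric.ball (0 : EuclideanSpace ℝ (Fin d)) 1)

lemma sphereArea_ne_top (d : ℕ) : sphereArea d ≠ ∞ :=
  ENNReal.mul_ne_top (ENNReal.natCast_ne_top d) measure_ball_lt_top.ne

lemma sphereArea_ne_zero (d : ℕ) [NeZero d] : sphereArea d ≠ 0 :=
  mul_ne_zero (Nat.cast_ne_zero.2 (NeZero.ne d)) (Metric.measure_ball_pos _ _ one_pos).ne'

lemma setLIntegral_norm_rpow (d : ℕ) [NeZero d] {S : Set ℝ} (hS : MeasurableSet S) (e : ℝ) :
    ∫⁻ x in {x : EuclideanSpace ℝ (Fin d) | ‖x‖ ∈ S}, ENNReal.ofReal (‖x‖ ^ e) =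
      sphereArea d * ∫⁻ r in Set.Ioi 0 ∩ S, ENNReal.ofReal (r ^ (e + d - 1)) := by
  have hd : 1 ≤ d := NeZero.one_le
  have hF : Measurable (S.indicator fun r : ℝ => ENNReal.ofReal (r ^ e)) :=
    Measurable.indicator (by fun_prop) hS
  have h := lintegral_fun_norm_addHaar (volume : Measure (EuclideanSpace ℝ (Fin d))) hF
  rw [finrank_euclideanSpace_fin] at h
  have hSm : MeasurableSet {x : EuclideanSpace ℝ (Fin d) | ‖x‖ ∈ S} := measurable_norm hS
  rw [← lintegral_indicator hSm, sphereArea]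
  refine Eq.trans ?_ (h.trans ?_)
  · refine lintegral_congr fun x => ?_
    by_cases hx : ‖x‖ ∈ S <;> simp [Set.indicator, hx]
  · congr 1
    rw [Set.inter_comm, ← Measure.restrict_restrict hS, ← lintegral_indicator hS]
    refine setLIntegral_congr_fun measurableSet_Ioi fun r hr => ?_
    by_cases hx : r ∈ S
    · simp only [hx, Set.indicator_of_mem]
      rw [← ENNReal.ofReal_mul (pow_nonneg (le_of_lt hr) _), ← Real.rpow_natCast,
        ← Real.rpow_add hr]
      congr 2
      push_cast [hd]
      ring
    · simp [hx]

lemma setLIntegral_ball_norm_rpow (d : ℕ) [NeZero d] {m R : ℝ} (hm : 0 < m) (hR : 0 ≤ R) :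
    ∫⁻ x in {x : EuclideanSpace ℝ (Fin d) | ‖x‖ < R}, ENNReal.ofReal (‖x‖ ^ (m - d)) =
      sphereArea d * ENNReal.ofReal (R ^ m / m) := by
  rw [← lintegral_Ioo_zero_rpow hm hR]
  have := setLIntegral_norm_rpow d (measurableSet_Iio (a := R)) (m - d)
  rw [Set.Ioi_inter_Iio, sub_add_cancel] at this
  exact this

lemma setLIntegral_compl_ball_norm_rpow (d : ℕ) [NeZero d] {m R : ℝ} (hm : 0 < m) (hR : 0 < R) :
    ∫⁻ x in {x : EuclideanSpace ℝ (Fin d) | R < ‖x‖}, ENNReal.ofReal (‖x‖ ^ (-m - d)) =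
      sphereArea d * ENNReal.ofReal (R ^ (-m) / m) := by
  rw [← lintegral_Ioi_rpow hm hR]
  have := setLIntegral_norm_rpow d (measurableSet_Ioi (a := R)) (-m - d)
  rw [Set.Ioi_inter_Ioi, sup_of_le_right hR.le, sub_add_cancel] at this
  exact this

lemma setLIntegral_annulus_norm_rpow (d : ℕ) [NeZero d] {a b : ℝ} (ha : 0 < a) (hab : a ≤ b) :
    ∫⁻ x in {x : EuclideanSpace ℝ (Fin d) | ‖x‖ ∈ Set.Ioo a b},
      ENNReal.ofReal (‖x‖ ^ (-(d : ℝ))) = sphereArea d * ENNReal.ofReal (Real.log (b / a)) := by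
  rw [← lintegral_Ioo_inv ha hab]
  have := setLIntegral_norm_rpow d (measurableSet_Ioo (a := a) (b := b)) (-(d : ℝ))
  have h2 : Set.Ioi 0 ∩ Set.Ioo a b = Set.Ioo a b :=
    Set.inter_eq_right.2 fun r hr => ha.trans hr.1
  rw [h2] at this
  simp only [neg_add_cancel, zero_sub, Real.rpow_neg_one] at this
  exact this

/-- Among sets of a given volume the integral of `|y - z|^{-γ}` is, up to a constant, largest for
the ball around `z`. -/
lemma exists_setLIntegral_norm_sub_rpow_le (d : ℕ) [NeZero d] {γ : ℝ} (hγ : 0 ≤ γ) (hγd : γ < d) :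
    ∃ C : ℝ≥0∞, C ≠ ∞ ∧ ∀ (F : Set (EuclideanSpace ℝ (Fin d))) (z : EuclideanSpace ℝ (Fin d)),
      ∫⁻ y in F, ENNReal.ofReal (‖y - z‖ ^ (-γ)) ≤ C * volume F ^ (1 - γ / d) := by
  have hd : (0 : ℝ) < d := by exact_mod_cast NeZero.pos d
  have hm : 0 < (d : ℝ) - γ := by linarith
  have he : 0 < 1 - γ / d := by rw [sub_pos, div_lt_one hd]; exact hγd
  refine ⟨sphereArea d * ENNReal.ofReal (1 / (d - γ)) + 1, ENNReal.add_ne_top.2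
    ⟨ENNReal.mul_ne_top (sphereArea_ne_top d) ENNReal.ofReal_ne_top, ENNReal.one_ne_top⟩, ?_⟩
  intro F z
  rcases eq_or_ne (volume F) 0 with h0 | h0
  · rw [Measure.restrict_eq_zero.2 h0]; simp
  rcases eq_or_ne (volume F) ∞ with h1 | h1
  · rw [h1, ENNReal.top_rpow_of_pos he, ENNReal.mul_top (by simp)]
    exact le_top
  -- the radius of a ball whose volume is comparable to that of `F`
  set v : ℝ := (volume F).toReal with hv
  have hvpos : 0 < v := ENNReal.toReal_pos h0 h1
  have hvF : volume F = ENNReal.ofReal v := (ENNReal.ofReal_toReal h1).symm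
  set R : ℝ := v ^ (1 / (d : ℝ)) with hR
  have hRpos : 0 < R := Real.rpow_pos_of_pos hvpos _
  have hpoint : ∀ y, ENNReal.ofReal (‖y - z‖ ^ (-γ)) ≤
      Set.indicator {y | ‖y - z‖ < R} (fun y => ENNReal.ofReal (‖y - z‖ ^ (((d : ℝ) - γ) - d))) y
        + ENNReal.ofReal (R ^ (-γ)) := by
    intro y
    by_cases hy : ‖y - z‖ < R
    · rw [Set.indicator_of_mem (show y ∈ {y | ‖y - z‖ < R} from hy)]
      rw [show (d : ℝ) - γ - d = -γ by ring]
      exact le_self_add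
    · refine le_trans (ENNReal.ofReal_le_ofReal ?_) le_add_self
      exact Real.rpow_le_rpow_of_nonpos hRpos (not_lt.1 hy) (by linarith)
  have hball : ∫⁻ y, Set.indicator {y | ‖y - z‖ < R}
      (fun y => ENNReal.ofReal (‖y - z‖ ^ (((d : ℝ) - γ) - d))) y =
      sphereArea d * ENNReal.ofReal (R ^ ((d : ℝ) - γ) / (d - γ)) := by
    rw [← setLIntegral_ball_norm_rpow d hm hRpos.le, ← lintegral_indicator
      (measurableSet_lt measurable_norm measurable_const)]
    exact lintegral_sub_right_eq_self (fun y : EuclideanSpace ℝ (Fin d) => Set.indicator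
      {y : EuclideanSpace ℝ (Fin d) | ‖y‖ < R}
      (fun y => ENNReal.ofReal (‖y‖ ^ (((d : ℝ) - γ) - d))) y) z
  calc ∫⁻ y in F, ENNReal.ofReal (‖y - z‖ ^ (-γ))
      ≤ ∫⁻ y in F, (Set.indicator {y | ‖y - z‖ < R}
          (fun y => ENNReal.ofReal (‖y - z‖ ^ (((d : ℝ) - γ) - d))) y
        + ENNReal.ofReal (R ^ (-γ))) := lintegral_mono hpoint
    _ = (∫⁻ y in F, Set.indicator {y | ‖y - z‖ < R}
          (fun y => ENNReal.ofReal (‖y - z‖ ^ (((d : ℝ) - γ) - d))) y)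
        + ENNReal.ofReal (R ^ (-γ)) * volume F := by
        rw [lintegral_add_right _ measurable_const, setLIntegral_const]
    _ ≤ sphereArea d * ENNReal.ofReal (R ^ ((d : ℝ) - γ) / (d - γ))
        + ENNReal.ofReal (R ^ (-γ)) * volume F := by
        gcongr
        rw [← hball]
        exact setLIntegral_le_lintegral _ _
    _ = _ := by
        have e1 : R ^ ((d : ℝ) - γ) = v ^ (1 - γ / d) := by
          rw [hR, ← Real.rpow_mul hvpos.le]; congr 1; field_simp
        have e2 : R ^ (-γ) * v = v ^ (1 - γ / d) := by
          rw [hR, ← Real.rpow_mul hvpos.le, ← Real.rpow_add_one hvpos.ne']; congr 1; ring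
        rw [hvF, ← ENNReal.ofReal_mul (by positivity), e1, e2, ENNReal.ofReal_rpow_of_pos hvpos,
          add_mul, one_mul, mul_assoc, ← ENNReal.ofReal_mul (by positivity)]
        congr 3
        ring

/-- The product is at most its value with both bases replaced by the smaller one. With the
convention `0 ^ (-t) = 0` this also holds at zero, because `t > 0`. -/
lemma rpow_neg_mul_rpow_neg_le {a b s t : ℝ} (ha : 0 ≤ a) (hb : 0 ≤ b) (hs : 0 ≤ s) (ht : 0 < t) :
    a ^ (-s) * b ^ (-t) ≤ a ^ (-(s + t)) + b ^ (-(s + t)) := by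
  have h1 := Real.rpow_nonneg ha (-(s + t))
  have h2 := Real.rpow_nonneg hb (-(s + t))
  rcases hb.eq_or_lt with rfl | hb
  · rw [Real.zero_rpow (by linarith : -t ≠ 0), mul_zero]; positivity
  rcases ha.eq_or_lt with rfl | ha
  · rcases hs.eq_or_lt with rfl | hs
    · simp only [neg_zero, Real.rpow_zero, one_mul, zero_add] at *
      linarith
    · rw [Real.zero_rpow (by linarith : -s ≠ 0), zero_mul]; positivity
  rcases le_total a b with hab | hab
  · calc a ^ (-s) * b ^ (-t) ≤ a ^ (-s) * a ^ (-t) :=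
        mul_le_mul_of_nonneg_left (Real.rpow_le_rpow_of_nonpos ha hab (by linarith))
          (Real.rpow_nonneg ha.le _)
      _ = a ^ (-(s + t)) := by rw [← Real.rpow_add ha]; congr 1; ring
      _ ≤ _ := by linarith
  · calc a ^ (-s) * b ^ (-t) ≤ b ^ (-s) * b ^ (-t) :=
        mul_le_mul_of_nonneg_right (Real.rpow_le_rpow_of_nonpos hb hab (by linarith))
          (Real.rpow_nonneg hb.le _)
      _ = b ^ (-(s + t)) := by rw [← Real.rpow_add hb]; congr 1; ring
      _ ≤ _ := by linarith

/-! ### The kernel and its restricted weak-type estimates -/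

/-- The kernel `|x|^{-β} |y|^{-α} |x - y|^{-λ}` of the weighted Riesz potential, as an extended
nonnegative number. -/
noncomputable def rieszKernel (d : ℕ) (α β lam : ℝ) (x y : EuclideanSpace ℝ (Fin d)) : ℝ≥0∞ :=
  ENNReal.ofReal (‖x‖ ^ (-β)) * ENNReal.ofReal (‖y‖ ^ (-α) * ‖x - y‖ ^ (-lam))

lemma measurable_rieszKernel (d : ℕ) (α β lam : ℝ) :
    Measurable (Function.uncurry (rieszKernel d α β lam)) := by
  unfold rieszKernel Function.uncurry
  fun_prop

lemma rieszKernel_swap (d : ℕ) (α β lam : ℝ) (x y : EuclideanSpace ℝ (Fin d)) :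
    rieszKernel d α β lam x y = rieszKernel d β α lam y x := by
  unfold rieszKernel
  have h1 := fun (z : EuclideanSpace ℝ (Fin d)) (e : ℝ) => Real.rpow_nonneg (norm_nonneg z) e
  rw [← ENNReal.ofReal_mul (h1 _ _), ← ENNReal.ofReal_mul (h1 _ _), norm_sub_rev]
  congr 1
  ring

/-- Restricted weak-type estimate of the kernel at the endpoint `p₊`. -/
lemma exists_setLIntegral_rieszKernel_le_pPlus (d : ℕ) [NeZero d] {α β lam : ℝ} (hα : 0 ≤ α)
    (hβ : 0 ≤ β) (hlam : 0 < lam) (hαd : α + lam < d) (hβd : β < d) :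
    ∃ C : ℝ≥0∞, C ≠ ∞ ∧ ∀ F G : Set (EuclideanSpace ℝ (Fin d)),
      ∫⁻ x in G, ∫⁻ y in F, rieszKernel d α β lam x y ≤
        C * (volume F ^ (1 - (α + lam) / d) * volume G ^ (1 - β / d)) := by
  obtain ⟨C₁, hC₁, h₁⟩ := exists_setLIntegral_norm_sub_rpow_le d (by linarith : 0 ≤ α + lam) hαd
  obtain ⟨C₂, hC₂, h₂⟩ := exists_setLIntegral_norm_sub_rpow_le d hβ hβd
  refine ⟨2 * C₁ * C₂, ENNReal.mul_ne_top (ENNReal.mul_ne_top (by simp) hC₁) hC₂, fun F G => ?_⟩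
  -- both singularities of the inner integrand are treated as one of order `α + λ`
  have hin : ∀ x : EuclideanSpace ℝ (Fin d),
      ∫⁻ y in F, ENNReal.ofReal (‖y‖ ^ (-α) * ‖x - y‖ ^ (-lam)) ≤
        2 * C₁ * volume F ^ (1 - (α + lam) / d) := by
    intro x
    calc ∫⁻ y in F, ENNReal.ofReal (‖y‖ ^ (-α) * ‖x - y‖ ^ (-lam))
        ≤ ∫⁻ y in F, (ENNReal.ofReal (‖y - 0‖ ^ (-(α + lam))) +
            ENNReal.ofReal (‖y - x‖ ^ (-(α + lam)))) := by
          refine lintegral_mono fun y => ?_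
          rw [← ENNReal.ofReal_add (Real.rpow_nonneg (norm_nonneg _) _)
            (Real.rpow_nonneg (norm_nonneg _) _), sub_zero, norm_sub_rev y x]
          exact ENNReal.ofReal_le_ofReal
            (rpow_neg_mul_rpow_neg_le (norm_nonneg _) (norm_nonneg _) hα hlam)
      _ = (∫⁻ y in F, ENNReal.ofReal (‖y - 0‖ ^ (-(α + lam)))) +
            ∫⁻ y in F, ENNReal.ofReal (‖y - x‖ ^ (-(α + lam))) :=
          lintegral_add_left (by fun_prop) _
      _ ≤ C₁ * volume F ^ (1 - (α + lam) / d) + C₁ * volume F ^ (1 - (α + lam) / d) :=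
          add_le_add (h₁ F 0) (h₁ F x)
      _ = _ := by ring
  have hout := h₂ G 0
  simp only [sub_zero] at hout
  calc ∫⁻ x in G, ∫⁻ y in F, rieszKernel d α β lam x y
      ≤ ∫⁻ x in G, ENNReal.ofReal (‖x‖ ^ (-β)) * (2 * C₁ * volume F ^ (1 - (α + lam) / d)) := by
        refine lintegral_mono fun x => ?_
        unfold rieszKernel
        rw [lintegral_const_mul _ (by fun_prop)]
        gcongr
        exact hin x
    _ = (∫⁻ x in G, ENNReal.ofReal (‖x‖ ^ (-β))) * (2 * C₁ * volume F ^ (1 - (α + lam) / d)) :=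
        lintegral_mul_const _ (by fun_prop)
    _ ≤ C₂ * volume G ^ (1 - β / d) * (2 * C₁ * volume F ^ (1 - (α + lam) / d)) := by gcongr
    _ = _ := by ring

/-- Restricted weak-type estimate of the kernel at the endpoint `p₋`. -/
lemma exists_setLIntegral_rieszKernel_le_pMinus (d : ℕ) [NeZero d] {α β lam : ℝ} (hα : 0 ≤ α)
    (hβ : 0 ≤ β) (hlam : 0 < lam) (hαd : α < d) (hβd : β + lam < d) :
    ∃ C : ℝ≥0∞, C ≠ ∞ ∧ ∀ F G : Set (EuclideanSpace ℝ (Fin d)),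
      ∫⁻ x in G, ∫⁻ y in F, rieszKernel d α β lam x y ≤
        C * (volume F ^ (1 - α / d) * volume G ^ (1 - (β + lam) / d)) := by
  obtain ⟨C, hC, h⟩ := exists_setLIntegral_rieszKernel_le_pPlus d hβ hα hlam hβd hαd
  refine ⟨C, hC, fun F G => ?_⟩
  rw [lintegral_lintegral_swap (measurable_rieszKernel d α β lam).aemeasurable,
    mul_comm (volume F ^ _)]
  simp only [rieszKernel_swap d α β lam]
  exact h G F

/-! ### Young's inequality for distribution functions -/

/-- A Young inequality for a form with two variables, in the shape of Hölder's inequality with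
three factors. -/
lemma lintegral_lintegral_prod_three_rpow_le {X Y : Type*} [MeasurableSpace X] [MeasurableSpace Y]
    {μ : Measure X} {ν : Measure Y} [SFinite μ] [SFinite ν] {u : X → ℝ≥0∞} {v : Y → ℝ≥0∞}
    {h k : X → Y → ℝ≥0∞} (hu : Measurable u) (hv : Measurable v)
    (hh : Measurable (Function.uncurry h)) (hk : Measurable (Function.uncurry k))
    {M N : ℝ≥0∞} (hM : ∀ᵐ x ∂μ, ∫⁻ y, h x y ∂ν ≤ M) (hN : ∀ᵐ y ∂ν, ∫⁻ x, k x y ∂μ ≤ N)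
    (hu1 : ∫⁻ x, u x ∂μ ≤ 1) (hv1 : ∫⁻ y, v y ∂ν ≤ 1)
    {a b c : ℝ} (ha : 0 ≤ a) (hb : 0 ≤ b) (hc : 0 ≤ c) (habc : a + b + c = 1) :
    ∫⁻ x, ∫⁻ y, (u x * v y) ^ a * (u x * h x y) ^ b * (v y * k x y) ^ c ∂ν ∂μ ≤
      M ^ b * N ^ c := by
  let f : Fin 3 → X × Y → ℝ≥0∞ :=
    ![fun z => u z.1 * v z.2, fun z => u z.1 * h z.1 z.2, fun z => v z.2 * k z.1 z.2]
  have hf0 : Measurable (fun z : X × Y => u z.1 * v z.2) := by fun_prop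
  have hf1 : Measurable (fun z : X × Y => u z.1 * h z.1 z.2) := (hu.comp measurable_fst).mul hh
  have hf2 : Measurable (fun z : X × Y => v z.2 * k z.1 z.2) := (hv.comp measurable_snd).mul hk
  have key := ENNReal.lintegral_prod_norm_pow_le (μ := μ.prod ν) Finset.univ (f := f)
    (p := ![a, b, c]) (by
      intro i _
      fin_cases i
      · exact hf0.aemeasurable
      · exact hf1.aemeasurable
      · exact hf2.aemeasurable)
    (by simp [Fin.sum_univ_three, habc]) (by intro i _; fin_cases i <;> simp [ha, hb, hc])
  simp only [Fin.prod_univ_three, f, Matrix.cons_val_zero, Matrix.cons_val_one,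
    Matrix.cons_val] at key
  have i0 : ∫⁻ z, u z.1 * v z.2 ∂(μ.prod ν) ≤ 1 := by
    rw [lintegral_prod_mul hu.aemeasurable hv.aemeasurable]
    exact mul_le_one' hu1 hv1
  have i1 : ∫⁻ z, u z.1 * h z.1 z.2 ∂(μ.prod ν) ≤ M := by
    rw [lintegral_prod _ hf1.aemeasurable]
    calc ∫⁻ x, ∫⁻ y, u x * h x y ∂ν ∂μ ≤ ∫⁻ x, u x * M ∂μ := by
          refine lintegral_mono_ae (hM.mono fun x hx => ?_)
          rw [lintegral_const_mul _ (show Measurable (h x) from hh.comp measurable_prodMk_left)]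
          gcongr
      _ = (∫⁻ x, u x ∂μ) * M := lintegral_mul_const _ hu
      _ ≤ M := mul_le_of_le_one_left' hu1
  have i2 : ∫⁻ z, v z.2 * k z.1 z.2 ∂(μ.prod ν) ≤ N := by
    rw [lintegral_prod_symm _ hf2.aemeasurable]
    calc ∫⁻ y, ∫⁻ x, v y * k x y ∂μ ∂ν ≤ ∫⁻ y, v y * N ∂ν := by
          refine lintegral_mono_ae (hN.mono fun y hy => ?_)
          rw [lintegral_const_mul _
            (show Measurable (fun x => k x y) from hk.comp measurable_prodMk_right)]
          gcongr
      _ = (∫⁻ y, v y ∂ν) * N := lintegral_mul_const _ hv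
      _ ≤ N := mul_le_of_le_one_left' hv1
  rw [lintegral_prod _ (by fun_prop)] at key
  calc _ ≤ _ := key
    _ ≤ 1 ^ a * M ^ b * N ^ c := by gcongr
    _ = _ := by rw [ENNReal.one_rpow, one_mul]

open Set in
/-- The part `b^s ≤ a^p` of the form in the distribution functions `u` and `v`, for functions of
norm one in `L^p` and `L^s`. In the variables `p log a` and `s log b` it is a convolution form, and
the bound is Young's inequality with the `L^{1/κ}` norm of an exponential kernel. -/
lemma lintegral_distrib_form_le {p s A B κ δ : ℝ} (hp : 1 ≤ p) (hs : 1 ≤ s) (hA1 : A ≤ 1)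
    (hB1 : B ≤ 1) (hκ0 : 0 < κ) (hκ1 : κ ≤ 1) (hABκ : A + B + κ = 2) (hδ : 0 < δ)
    (hA : A - 1 / p = δ) (hB : 1 / s - B = δ) {u v : ℝ → ℝ≥0∞} (hu : Measurable u)
    (hv : Measurable v) (hu1 : ∫⁻ a in Ioi 0, u a * ENNReal.ofReal (a ^ (p - 1)) ≤ 1)
    (hv1 : ∫⁻ b in Ioi 0, v b * ENNReal.ofReal (b ^ (s - 1)) ≤ 1) :
    ∫⁻ a in Ioi (0 : ℝ), ∫⁻ b in Ioi (0 : ℝ),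
      {z : ℝ × ℝ | z.2 ^ s ≤ z.1 ^ p}.indicator (fun z => u z.1 ^ A * v z.2 ^ B) (a, b) ≤
      ENNReal.ofReal ((κ / δ) ^ κ) := by
  have hp0 : 0 < p := by linarith
  have hs0 : 0 < s := by linarith
  set m := δ / κ with hm
  have hm0 : 0 < m := div_pos hδ hκ0
  set D : Set (ℝ × ℝ) := {z | z.2 ^ s ≤ z.1 ^ p} with hD
  have hDm : MeasurableSet D := measurableSet_le (by fun_prop) (by fun_prop)
  -- the same kernel `(a^{-p} b^s)^m` on `b^s ≤ a^p`, normalized by `db / b` in `h` and by `da / a`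
  -- in `k`
  let h : ℝ → ℝ → ℝ≥0∞ := fun a b =>
    D.indicator (fun z => ENNReal.ofReal (z.1 ^ (-(p * m)) * z.2 ^ (s * m - 1))) (a, b)
  let k : ℝ → ℝ → ℝ≥0∞ := fun a b =>
    D.indicator (fun z => ENNReal.ofReal (z.1 ^ (-(p * m) - 1) * z.2 ^ (s * m))) (a, b)
  have hh : Measurable (Function.uncurry h) :=
    Measurable.indicator (f := fun z : ℝ × ℝ =>
      ENNReal.ofReal (z.1 ^ (-(p * m)) * z.2 ^ (s * m - 1))) (by fun_prop) hDm
  have hk : Measurable (Function.uncurry k) :=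
    Measurable.indicator (f := fun z : ℝ × ℝ =>
      ENNReal.ofReal (z.1 ^ (-(p * m) - 1) * z.2 ^ (s * m))) (by fun_prop) hDm
  have hM : ∀ᵐ a ∂(volume.restrict (Ioi (0 : ℝ))),
      ∫⁻ b in Ioi (0 : ℝ), h a b ≤ ENNReal.ofReal m⁻¹ := by
    filter_upwards [ae_restrict_mem measurableSet_Ioi] with a (ha : 0 < a)
    calc ∫⁻ b in Ioi (0 : ℝ), h a b
        ≤ ∫⁻ b in Ioi (0 : ℝ), (Ioc 0 (a ^ (p / s))).indicator (fun b =>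
            ENNReal.ofReal (a ^ (-(p * m))) * ENNReal.ofReal (b ^ (s * m - 1))) b := by
          refine setLIntegral_mono' measurableSet_Ioi fun b (hb : 0 < b) => ?_
          simp only [h]
          by_cases hab : (a, b) ∈ D
          · have hb' : b ∈ Ioc 0 (a ^ (p / s)) := by
              refine ⟨hb, ?_⟩
              have hab : b ^ s ≤ a ^ p := hab
              rw [← Real.rpow_le_rpow_iff hb.le (by positivity) hs0, ← Real.rpow_mul ha.le,
                div_mul_cancel₀ _ hs0.ne']
              exact hab
            rw [indicator_of_mem hab, indicator_of_mem hb', ENNReal.ofReal_mul (by positivity)]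
          · rw [indicator_of_notMem hab]; exact bot_le
      _ ≤ ∫⁻ b in Ioc 0 (a ^ (p / s)),
            ENNReal.ofReal (a ^ (-(p * m))) * ENNReal.ofReal (b ^ (s * m - 1)) := by
          rw [← lintegral_indicator measurableSet_Ioc]
          exact setLIntegral_le_lintegral _ _
      _ = ENNReal.ofReal (a ^ (-(p * m))) * ENNReal.ofReal ((a ^ (p / s)) ^ (s * m) / (s * m)) := by
          rw [setLIntegral_congr Ioo_ae_eq_Ioc.symm, lintegral_const_mul _ (by fun_prop),
            lintegral_Ioo_zero_rpow (by positivity) (by positivity)]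
      _ ≤ ENNReal.ofReal m⁻¹ := by
          rw [← ENNReal.ofReal_mul (by positivity)]
          refine ENNReal.ofReal_le_ofReal ?_
          rw [← Real.rpow_mul ha.le, ← mul_div_assoc, ← Real.rpow_add ha,
            show -(p * m) + p / s * (s * m) = 0 by field_simp; ring, Real.rpow_zero, one_div]
          exact inv_anti₀ hm0 (le_mul_of_one_le_left hm0.le hs)
  have hN : ∀ᵐ b ∂(volume.restrict (Ioi (0 : ℝ))),
      ∫⁻ a in Ioi (0 : ℝ), k a b ≤ ENNReal.ofReal m⁻¹ := by
    filter_upwards [ae_restrict_mem measurableSet_Ioi] with b (hb : 0 < b)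
    calc ∫⁻ a in Ioi (0 : ℝ), k a b
        ≤ ∫⁻ a in Ioi (0 : ℝ), (Ici (b ^ (s / p))).indicator (fun a =>
            ENNReal.ofReal (a ^ (-(p * m) - 1)) * ENNReal.ofReal (b ^ (s * m))) a := by
          refine setLIntegral_mono' measurableSet_Ioi fun a (ha : 0 < a) => ?_
          simp only [k]
          by_cases hab : (a, b) ∈ D
          · have hb' : a ∈ Ici (b ^ (s / p)) := by
              have hab : b ^ s ≤ a ^ p := hab
              rw [mem_Ici, ← Real.rpow_le_rpow_iff (by positivity) ha.le hp0, ← Real.rpow_mul hb.le,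
                div_mul_cancel₀ _ hp0.ne']
              exact hab
            rw [indicator_of_mem hab, indicator_of_mem hb', ENNReal.ofReal_mul (by positivity)]
          · rw [indicator_of_notMem hab]; exact bot_le
      _ ≤ ∫⁻ a in Ici (b ^ (s / p)),
            ENNReal.ofReal (a ^ (-(p * m) - 1)) * ENNReal.ofReal (b ^ (s * m)) := by
          rw [← lintegral_indicator measurableSet_Ici]
          exact setLIntegral_le_lintegral _ _
      _ = ENNReal.ofReal ((b ^ (s / p)) ^ (-(p * m)) / (p * m)) * ENNReal.ofReal (b ^ (s * m)) := by
          rw [setLIntegral_congr Ioi_ae_eq_Ici.symm, lintegral_mul_const _ (by fun_prop),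
            lintegral_Ioi_rpow (by positivity) (by positivity)]
      _ ≤ ENNReal.ofReal m⁻¹ := by
          rw [← ENNReal.ofReal_mul (by positivity)]
          refine ENNReal.ofReal_le_ofReal ?_
          rw [← Real.rpow_mul hb.le, div_mul_eq_mul_div, ← Real.rpow_add hb,
            show s / p * -(p * m) + s * m = 0 by field_simp; ring, Real.rpow_zero, one_div]
          exact inv_anti₀ hm0 (le_mul_of_one_le_left hm0.le hp)
  have key := lintegral_lintegral_prod_three_rpow_le (μ := volume.restrict (Ioi (0 : ℝ)))
    (ν := volume.restrict (Ioi (0 : ℝ))) (u := fun a => u a * ENNReal.ofReal (a ^ (p - 1)))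
    (v := fun b => v b * ENNReal.ofReal (b ^ (s - 1))) (by fun_prop) (by fun_prop) hh hk hM hN
    hu1 hv1 (a := 1 - κ) (b := 1 - B) (c := 1 - A) (by linarith) (by linarith) (by linarith)
    (by linarith)
  refine le_trans (setLIntegral_mono' measurableSet_Ioi fun a (ha : 0 < a) =>
    setLIntegral_mono' measurableSet_Ioi fun b (hb : 0 < b) => ?_) (key.trans_eq ?_)
  · by_cases hab : (a, b) ∈ D
    swap
    · rw [indicator_of_notMem hab]; exact bot_le
    simp only [h, k, indicator_of_mem hab]
    have hpd : p * δ = p * A - 1 := by rw [← hA]; field_simp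
    have hsd : s * δ = 1 - s * B := by rw [← hB]; field_simp
    have hmκ : m * κ = δ := by rw [hm]; field_simp
    have ea : a ^ ((p - 1) * (1 - κ)) * a ^ ((p - 1) * (1 - B)) * a ^ (-(p * m) * (1 - B)) *
        a ^ ((-(p * m) - 1) * (1 - A)) = 1 := by
      have : (p - 1) * (1 - κ) + (p - 1) * (1 - B) + -(p * m) * (1 - B) +
          (-(p * m) - 1) * (1 - A) = 0 := by
        linear_combination (1 - p + p * m) * hABκ - hpd - p * hmκ
      rw [← Real.rpow_add ha, ← Real.rpow_add ha, ← Real.rpow_add ha, this, Real.rpow_zero]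
    have eb : b ^ ((s - 1) * (1 - κ)) * b ^ ((s * m - 1) * (1 - B)) * b ^ ((s - 1) * (1 - A)) *
        b ^ (s * m * (1 - A)) = 1 := by
      have : (s - 1) * (1 - κ) + (s * m - 1) * (1 - B) + (s - 1) * (1 - A) + s * m * (1 - A)
          = 0 := by
        linear_combination (1 - s - s * m) * hABκ + hsd + s * hmκ
      rw [← Real.rpow_add hb, ← Real.rpow_add hb, ← Real.rpow_add hb, this, Real.rpow_zero]
    -- the powers of `a` and of `b` cancel
    have w : (a ^ (p - 1) * b ^ (s - 1)) ^ (1 - κ) *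
        (a ^ (p - 1) * (a ^ (-(p * m)) * b ^ (s * m - 1))) ^ (1 - B) *
        (b ^ (s - 1) * (a ^ (-(p * m) - 1) * b ^ (s * m))) ^ (1 - A) = 1 := by
      have ha' := fun e : ℝ => Real.rpow_nonneg ha.le e
      have hb' := fun e : ℝ => Real.rpow_nonneg hb.le e
      rw [Real.mul_rpow (ha' _) (hb' _), Real.mul_rpow (ha' _) (mul_nonneg (ha' _) (hb' _)),
        Real.mul_rpow (ha' _) (hb' _), Real.mul_rpow (hb' _) (mul_nonneg (ha' _) (hb' _)),
        Real.mul_rpow (ha' _) (hb' _)]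
      simp only [← Real.rpow_mul ha.le, ← Real.rpow_mul hb.le]
      have hab1 := (congrArg₂ (· * ·) ea eb).trans (mul_one 1)
      refine Eq.trans ?_ hab1
      ring
    have w' := congrArg ENNReal.ofReal w
    rw [ENNReal.ofReal_mul (by positivity), ENNReal.ofReal_mul (by positivity),
      ← ENNReal.ofReal_rpow_of_pos (by positivity), ← ENNReal.ofReal_rpow_of_pos (by positivity),
      ← ENNReal.ofReal_rpow_of_pos (by positivity), ENNReal.ofReal_mul (by positivity),
      ENNReal.ofReal_mul (p := a ^ (p - 1)) (by positivity),
      ENNReal.ofReal_mul (p := b ^ (s - 1)) (by positivity), ENNReal.ofReal_one] at w'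
    have hκ' : 0 ≤ 1 - κ := by linarith
    have hA' : 0 ≤ 1 - A := by linarith
    have hB' : 0 ≤ 1 - B := by linarith
    calc u a ^ A * v b ^ B = u a ^ (1 - κ + (1 - B)) * v b ^ (1 - κ + (1 - A)) * 1 := by
          rw [mul_one]; congr 2 <;> linarith
      _ = _ := by
          rw [← w', ENNReal.rpow_add_of_nonneg _ _ hκ' hB', ENNReal.rpow_add_of_nonneg _ _ hκ' hA']
          simp only [ENNReal.mul_rpow_of_nonneg _ _ hκ', ENNReal.mul_rpow_of_nonneg _ _ hA',
            ENNReal.mul_rpow_of_nonneg _ _ hB']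
          ring
      _ ≤ _ := le_rfl
  · rw [← ENNReal.rpow_add_of_nonneg _ _ (by linarith) (by linarith),
      show 1 - B + (1 - A) = κ by linarith, ENNReal.ofReal_rpow_of_pos (by positivity), hm, inv_div]

/-! ### Layer-cake representation and duality -/

open Set in
lemma lintegral_ofReal_mul_eq_lintegral_setLIntegral {Y : Type*} [MeasurableSpace Y]
    (ν : Measure Y) {f : Y → ℝ} (hf : Measurable f) (hf0 : ∀ y, 0 ≤ f y) {w : Y → ℝ≥0∞}
    (hw : Measurable w) :
    ∫⁻ y, ENNReal.ofReal (f y) * w y ∂ν = ∫⁻ a in Ioi (0 : ℝ), ∫⁻ y in {y | a < f y}, w y ∂ν := by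
  have h1 := lintegral_withDensity_eq_lintegral_mul ν hw hf.ennreal_ofReal
  have h2 := lintegral_eq_lintegral_meas_lt (ν.withDensity w) (Filter.Eventually.of_forall hf0)
    hf.aemeasurable
  calc ∫⁻ y, ENNReal.ofReal (f y) * w y ∂ν
      = ∫⁻ y, (w * fun y => ENNReal.ofReal (f y)) y ∂ν :=
        lintegral_congr fun y => by rw [Pi.mul_apply, mul_comm]
    _ = _ := by
      rw [← h1, h2]
      refine lintegral_congr fun a => ?_
      rw [withDensity_apply _ (measurableSet_lt measurable_const hf)]

open Set in
/-- Layer-cake representation of a bilinear form with nonnegative kernel. -/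
lemma lintegral_lintegral_eq_layercake {X Y : Type*} [MeasurableSpace X] [MeasurableSpace Y]
    (μ : Measure X) (ν : Measure Y) [SFinite μ] [SFinite ν] {k : X → Y → ℝ≥0∞}
    (hk : Measurable (Function.uncurry k)) {f : Y → ℝ} (hf : Measurable f) (hf0 : ∀ y, 0 ≤ f y)
    {g : X → ℝ} (hg : Measurable g) (hg0 : ∀ x, 0 ≤ g x) :
    ∫⁻ x, ENNReal.ofReal (g x) * ∫⁻ y, ENNReal.ofReal (f y) * k x y ∂ν ∂μ =
      ∫⁻ a in Ioi (0 : ℝ), ∫⁻ b in Ioi (0 : ℝ),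
        ∫⁻ x in {x | b < g x}, ∫⁻ y in {y | a < f y}, k x y ∂ν ∂μ := by
  have hk' : ∀ x, Measurable (k x) := fun x => hk.comp measurable_prodMk_left
  have hΦ : Measurable fun z : X × ℝ => ∫⁻ y in {y | z.2 < f y}, k z.1 y ∂ν := by
    have : (fun z : X × ℝ => ∫⁻ y in {y | z.2 < f y}, k z.1 y ∂ν) = fun z : X × ℝ =>
        ∫⁻ y, {w : (X × ℝ) × Y | w.1.2 < f w.2}.indicator (fun w => k w.1.1 w.2) (z, y) ∂ν := by
      funext z
      rw [← lintegral_indicator (measurableSet_lt measurable_const hf)]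
      rfl
    rw [this]
    refine Measurable.lintegral_prod_right' (f := {w : (X × ℝ) × Y | w.1.2 < f w.2}.indicator
      (fun w => k w.1.1 w.2)) ?_
    refine Measurable.indicator ?_ (measurableSet_lt (by fun_prop) (by fun_prop))
    exact hk.comp (f := fun w : (X × ℝ) × Y => (w.1.1, w.2)) (by fun_prop)
  calc ∫⁻ x, ENNReal.ofReal (g x) * ∫⁻ y, ENNReal.ofReal (f y) * k x y ∂ν ∂μ
      = ∫⁻ x, (∫⁻ a in Ioi (0 : ℝ),
          ENNReal.ofReal (g x) * ∫⁻ y in {y | a < f y}, k x y ∂ν) ∂μ := by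
        refine lintegral_congr fun x => ?_
        rw [lintegral_ofReal_mul_eq_lintegral_setLIntegral ν hf hf0 (hk' x)]
        exact (lintegral_const_mul _ (hΦ.comp measurable_prodMk_left)).symm
    _ = ∫⁻ a in Ioi (0 : ℝ), ∫⁻ x,
          ENNReal.ofReal (g x) * ∫⁻ y in {y | a < f y}, k x y ∂ν ∂μ := by
        refine lintegral_lintegral_swap (Measurable.aemeasurable ?_)
        exact Measurable.mul (by fun_prop) hΦ
    _ = _ := by
        refine lintegral_congr fun a => ?_
        exact lintegral_ofReal_mul_eq_lintegral_setLIntegral μ hg hg0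
          (hΦ.comp (f := fun x : X => (x, a)) (by fun_prop))

open Set in
lemma lintegral_meas_lt_mul_rpow_le_one {X : Type*} [MeasurableSpace X] {μ : Measure X} {p : ℝ}
    (hp : 1 ≤ p) {f : X → ℝ} (hf : Measurable f) (hf0 : ∀ x, 0 ≤ f x)
    (h : ∫⁻ x, ENNReal.ofReal (f x ^ p) ∂μ ≤ 1) :
    ∫⁻ t in Ioi (0 : ℝ), μ {x | t < f x} * ENNReal.ofReal (t ^ (p - 1)) ≤ 1 := by
  rw [lintegral_rpow_eq_lintegral_meas_lt_mul μ (Filter.Eventually.of_forall hf0) hf.aemeasurable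
    (by linarith)] at h
  refine le_trans (le_mul_of_one_le_left bot_le ?_) h
  simpa using ENNReal.ofReal_le_ofReal hp

open Filter Topology in
/-- The converse of Hölder's inequality: the dual norm controls the `L^q` norm, with no a priori
finiteness. -/
lemma lintegral_rpow_le_of_forall_lintegral_mul_le {X : Type*} [MeasurableSpace X] {μ : Measure X}
    [SigmaFinite μ] {q s : ℝ} (hqs : q.HolderConjugate s) {h : X → ℝ≥0∞} (hh : Measurable h)
    {M : ℝ≥0∞} (H : ∀ g : X → ℝ, Measurable g → (∀ x, 0 ≤ g x) →
      ∫⁻ x, ENNReal.ofReal (g x ^ s) ∂μ ≤ 1 → ∫⁻ x, ENNReal.ofReal (g x) * h x ∂μ ≤ M) :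
    ∫⁻ x, h x ^ q ∂μ ≤ M ^ q := by
  have hq0 : 0 < q := hqs.pos
  have hs0 : 0 < s := hqs.symm.pos
  have hq1 : 0 < q - 1 := hqs.sub_one_pos
  set t : ℕ → X → ℝ≥0∞ := fun n => (spanningSets μ n).indicator fun x => min (h x) n with ht
  have htm : ∀ n, Measurable (t n) := fun n =>
    (hh.min measurable_const).indicator (measurableSet_spanningSets μ n)
  have hth : ∀ n x, t n x ≤ h x := fun n x =>
    (Set.indicator_le_self _ _ x).trans (min_le_left _ _)
  have htn : ∀ n x, t n x ≤ n := fun n x =>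
    (Set.indicator_le_self _ _ x).trans (min_le_right _ _)
  have htt : ∀ n x, t n x ≠ ∞ := fun n x => ne_top_of_le_ne_top (ENNReal.natCast_ne_top n) (htn n x)
  have hbound : ∀ n, ∫⁻ x, t n x ^ q ∂μ ≤ M ^ q := by
    intro n
    set N := ∫⁻ x, t n x ^ q ∂μ with hN
    rcases eq_or_ne N 0 with hN0 | hN0
    · rw [hN0]; exact bot_le
    have hNtop : N ≠ ∞ := by
      refine ne_top_of_le_ne_top (b := (n : ℝ≥0∞) ^ q * μ (spanningSets μ n))
        (ENNReal.mul_ne_top (ENNReal.rpow_ne_top_of_nonneg hq0.le (ENNReal.natCast_ne_top n))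
          (measure_spanningSets_lt_top μ n).ne) ?_
      rw [← setLIntegral_const, ← lintegral_indicator (measurableSet_spanningSets μ n)]
      refine lintegral_mono fun x => ?_
      by_cases hx : x ∈ spanningSets μ n
      · rw [Set.indicator_of_mem hx]
        exact ENNReal.rpow_le_rpow (htn n x) hq0.le
      · simp [ht, hx, hq0]
    -- the extremal function for the truncation
    set G : X → ℝ≥0∞ := fun x => t n x ^ (q - 1) * (N ^ (1 / s))⁻¹ with hG
    have hGm : Measurable G := ((htm n).pow_const _).mul_const _
    have hNs : (N ^ (1 / s))⁻¹ ≠ ∞ := by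
      simp [hN0, hNtop]
    have hGtop : ∀ x, G x ≠ ∞ := fun x =>
      ENNReal.mul_ne_top (ENNReal.rpow_ne_top_of_nonneg hq1.le (htt n x)) hNs
    have hG1 : ∫⁻ x, ENNReal.ofReal ((G x).toReal ^ s) ∂μ ≤ 1 := by
      have : ∀ x, ENNReal.ofReal ((G x).toReal ^ s) = t n x ^ q * N⁻¹ := by
        intro x
        rw [← ENNReal.ofReal_rpow_of_nonneg ENNReal.toReal_nonneg hs0.le,
          ENNReal.ofReal_toReal (hGtop x), hG, ENNReal.mul_rpow_of_nonneg _ _ hs0.le,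
          ← ENNReal.rpow_mul, hqs.sub_one_mul_conj, ← ENNReal.inv_rpow, ← ENNReal.rpow_mul,
          one_div_mul_cancel hs0.ne', ENNReal.rpow_one]
      simp only [this]
      rw [lintegral_mul_const _ ((htm n).pow_const _), ENNReal.mul_inv_cancel hN0 hNtop]
    have hM := H (fun x => (G x).toReal) hGm.ennreal_toReal (fun x => ENNReal.toReal_nonneg) hG1
    have hlow : N * (N ^ (1 / s))⁻¹ ≤ M := by
      refine le_trans ?_ hM
      rw [hN, ← lintegral_mul_const _ ((htm n).pow_const _)]
      refine lintegral_mono fun x => ?_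
      rw [ENNReal.ofReal_toReal (hGtop x), hG, mul_right_comm]
      gcongr
      calc t n x ^ q = t n x ^ (q - 1) * t n x ^ (1 : ℝ) := by
            rw [← ENNReal.rpow_add_of_nonneg _ _ hq1.le zero_le_one, sub_add_cancel]
        _ ≤ t n x ^ (q - 1) * h x := by
            rw [ENNReal.rpow_one]
            gcongr
            exact hth n x
    have hpow : N * (N ^ (1 / s))⁻¹ = N ^ (1 / q) := by
      rw [← ENNReal.rpow_neg]
      nth_rewrite 1 [← ENNReal.rpow_one N]
      rw [← ENNReal.rpow_add _ _ hN0 hNtop]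
      congr 1
      have := hqs.inv_add_inv_eq_one
      rw [one_div, one_div]; linarith
    rw [hpow] at hlow
    calc N = (N ^ (1 / q)) ^ q := by
          rw [← ENNReal.rpow_mul, one_div_mul_cancel hq0.ne', ENNReal.rpow_one]
      _ ≤ M ^ q := ENNReal.rpow_le_rpow hlow hq0.le
  have hlim : ∀ x, Tendsto (fun n => t n x ^ q) atTop (𝓝 (h x ^ q)) := by
    intro x
    refine (ENNReal.continuous_rpow_const.tendsto (h x)).comp ?_
    have h1 : Tendsto (fun n : ℕ => min (h x) (n : ℝ≥0∞)) atTop (𝓝 (min (h x) ∞)) :=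
      tendsto_const_nhds.min ENNReal.tendsto_nat_nhds_top
    rw [min_eq_left le_top] at h1
    refine h1.congr' ?_
    filter_upwards [eventually_ge_atTop (spanningSetsIndex μ x)] with n hn
    have : x ∈ spanningSets μ n := monotone_spanningSets μ hn (mem_spanningSetsIndex μ x)
    rw [ht]; simp [this]
  calc ∫⁻ x, h x ^ q ∂μ = ∫⁻ x, liminf (fun n => t n x ^ q) atTop ∂μ :=
        lintegral_congr fun x => (hlim x).liminf_eq.symm
    _ ≤ liminf (fun n => ∫⁻ x, t n x ^ q ∂μ) atTop :=
        lintegral_liminf_le fun n => (htm n).pow_const _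
    _ ≤ liminf (fun _ : ℕ => M ^ q) atTop := liminf_le_liminf (Eventually.of_forall hbound)
    _ = M ^ q := liminf_const _

/-! ### The strong-type upper bound -/

/-- The distance `1/p₋ - 1/p` of `1/p` from the endpoint `1/p₋ = 1 - α/d`. -/
noncomputable def gapMinus (d : ℕ) (α p : ℝ) : ℝ := 1 - α / d - 1 / p

/-- The distance `1/p - 1/p₊` of `1/p` from the endpoint `1/p₊ = 1 - (α + λ)/d`. -/
noncomputable def gapPlus (d : ℕ) (α lam p : ℝ) : ℝ := 1 / p - (1 - (α + lam) / d)

section Exponents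

variable {d : ℕ} {α β lam p q : ℝ}

lemma one_le_pMinus (hα : 0 ≤ α) (hαd : α < d) : 1 ≤ pMinus d α := by
  rw [pMinus, le_div_iff₀ (by linarith)]; linarith

lemma gapMinus_eq (hα : 0 ≤ α) (hαd : α < d) (hp : pMinus d α < p) :
    gapMinus d α p = (p - pMinus d α) / (p * pMinus d α) := by
  have h1 := one_le_pMinus hα hαd
  have hd : (0 : ℝ) < d := by linarith
  have hp0 : 0 < p := by linarith
  have hdα : (d : ℝ) - α ≠ 0 := by linarith
  rw [gapMinus, pMinus]
  field_simp

lemma gapPlus_eq (hαd : α + lam < d) (hd : (0 : ℝ) < d) (hp0 : 0 < p) :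
    gapPlus d α lam p = (pPlus d α lam - p) / (p * pPlus d α lam) := by
  have hdα : (d : ℝ) - α - lam ≠ 0 := by linarith
  rw [gapPlus, pPlus]
  field_simp
  ring

lemma gapMinus_pos (hα : 0 ≤ α) (hαd : α < d) (hp : pMinus d α < p) : 0 < gapMinus d α p := by
  have h1 := one_le_pMinus hα hαd
  rw [gapMinus_eq hα hαd hp]
  have : 0 < p - pMinus d α := by linarith
  have : 0 < p := by linarith
  positivity

lemma gapPlus_pos (hαd : α + lam < d) (hd : (0 : ℝ) < d) (hp0 : 0 < p) (hp : p < pPlus d α lam) :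
    0 < gapPlus d α lam p := by
  rw [gapPlus_eq hαd hd hp0]
  have : 0 < pPlus d α lam - p := by linarith
  have : 0 < pPlus d α lam := by linarith
  positivity

lemma gapMinus_eq_of_mem_rieszG (hG : (p, q) ∈ rieszG d α β lam) :
    gapMinus d α p = (β + lam) / d - 1 / q := by
  have h : 1 + 1 / q = 1 / p + (α + β + lam) / d := hG.2.2
  rw [gapMinus]
  linear_combination h

lemma gapPlus_eq_of_mem_rieszG (hG : (p, q) ∈ rieszG d α β lam) :
    gapPlus d α lam p = 1 / q - β / d := by
  have h : 1 + 1 / q = 1 / p + (α + β + lam) / d := hG.2.2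
  rw [gapPlus]
  linear_combination -h

lemma lt_of_mem_rieszG (hd : (0 : ℝ) < d) (hsum : α + β + lam < d)
    (hG : (p, q) ∈ rieszG d α β lam) : p < q := by
  have h : 1 + 1 / q = 1 / p + (α + β + lam) / d := hG.2.2
  have h1 : (α + β + lam) / d < 1 := (div_lt_one hd).2 hsum
  exact lt_of_one_div_lt_one_div hG.2.1 (by linarith)

end Exponents

open Set in
/-- The bilinear form of the kernel on the unit balls of `L^p` and of the dual of `L^q`. -/
lemma exists_lintegral_mul_lintegral_rieszKernel_le (d : ℕ) [NeZero d] {α β lam : ℝ} (hα : 0 ≤ α)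
    (hβ : 0 ≤ β) (hlam : 0 < lam) (hsum : α + β + lam < d) :
    ∃ C : ℝ≥0∞, C ≠ ∞ ∧ ∀ p q s : ℝ, (p, q) ∈ rieszG d α β lam →
      p ∈ Ioo (pMinus d α) (pPlus d α lam) → q.HolderConjugate s →
      ∀ f g : EuclideanSpace ℝ (Fin d) → ℝ, Measurable f → (∀ x, 0 ≤ f x) → Measurable g →
        (∀ x, 0 ≤ g x) → ∫⁻ x, ENNReal.ofReal (f x ^ p) ≤ 1 →
        ∫⁻ x, ENNReal.ofReal (g x ^ s) ≤ 1 →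
        ∫⁻ x, ENNReal.ofReal (g x) * ∫⁻ y, ENNReal.ofReal (f y) * rieszKernel d α β lam x y ≤
          C * (ENNReal.ofReal ((rieszKappa d α β lam / gapMinus d α p) ^ rieszKappa d α β lam) +
            ENNReal.ofReal
              ((rieszKappa d α β lam / gapPlus d α lam p) ^ rieszKappa d α β lam)) := by
  have hd : (0 : ℝ) < d := by exact_mod_cast NeZero.pos d
  obtain ⟨C₁, hC₁, h₁⟩ := exists_setLIntegral_rieszKernel_le_pMinus d hα hβ hlam
    (by linarith) (by linarith)
  obtain ⟨C₂, hC₂, h₂⟩ := exists_setLIntegral_rieszKernel_le_pPlus d hα hβ hlam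
    (by linarith) (by linarith)
  refine ⟨C₁ + C₂, ENNReal.add_ne_top.2 ⟨hC₁, hC₂⟩, ?_⟩
  intro p q s hG hp hqs f g hf hf0 hg hg0 hf1 hg1
  set κ := rieszKappa d α β lam with hκ
  have hκ0 : 0 < κ := div_pos (by linarith) hd
  have hκ1 : κ < 1 := (div_lt_one hd).2 hsum
  have hp1 : 1 < p := (one_le_pMinus hα (by linarith)).trans_lt hp.1
  have hs1 : 1 < s := hqs.symm.lt
  have hδ₁ : 0 < gapMinus d α p := gapMinus_pos hα (by linarith) hp.1
  have hδ₂ : 0 < gapPlus d α lam p := gapPlus_pos (by linarith) hd (by linarith) hp.2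
  have e₁ := gapMinus_eq_of_mem_rieszG hG
  have e₂ := gapPlus_eq_of_mem_rieszG hG
  have hs : 1 / s = 1 - 1 / q := by
    have := hqs.inv_add_inv_eq_one
    rw [one_div, one_div]; linarith
  have hsumd : α / d + β / d + lam / d = κ := by rw [hκ, rieszKappa]; ring
  set u : ℝ → ℝ≥0∞ := fun a => volume {y | a < f y} with hu
  set v : ℝ → ℝ≥0∞ := fun b => volume {x | b < g x} with hv
  have hum : Measurable u :=
    Antitone.measurable fun a b hab => measure_mono fun x (hx : b < f x) => hab.trans_lt hx
  have hvm : Measurable v :=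
    Antitone.measurable fun a b hab => measure_mono fun x (hx : b < g x) => hab.trans_lt hx
  have hu1 := lintegral_meas_lt_mul_rpow_le_one hp1.le hf hf0 hf1
  have hv1 := lintegral_meas_lt_mul_rpow_le_one hs1.le hg hg0 hg1
  have key₁ := lintegral_distrib_form_le (p := p) (s := s) (A := 1 - α / d)
    (B := 1 - (β + lam) / d) (κ := κ) (δ := gapMinus d α p) hp1.le hs1.le
    (sub_le_self _ (by positivity)) (sub_le_self _ (by positivity)) hκ0 hκ1.le
    (by rw [← hsumd]; ring) hδ₁ rfl (by rw [hs, e₁]; ring) hum hvm hu1 hv1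
  -- the other half of the level plane, with the roles of `f` and `g` exchanged
  have key₂ := lintegral_distrib_form_le (p := s) (s := p) (A := 1 - β / d)
    (B := 1 - (α + lam) / d) (κ := κ) (δ := gapPlus d α lam p) hs1.le hp1.le
    (sub_le_self _ (by positivity)) (sub_le_self _ (by positivity)) hκ0 hκ1.le
    (by rw [← hsumd]; ring) hδ₂ (by rw [hs, e₂]; ring) rfl hvm hum hv1 hu1
  have m₁ : Measurable ({z : ℝ × ℝ | z.2 ^ s ≤ z.1 ^ p}.indicator
      fun z => u z.1 ^ (1 - α / d) * v z.2 ^ (1 - (β + lam) / d)) :=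
    Measurable.indicator (by fun_prop) (measurableSet_le (by fun_prop) (by fun_prop))
  have m₂ : Measurable ({z : ℝ × ℝ | z.2 ^ p ≤ z.1 ^ s}.indicator
      fun z => v z.1 ^ (1 - β / d) * u z.2 ^ (1 - (α + lam) / d)) :=
    Measurable.indicator (by fun_prop) (measurableSet_le (by fun_prop) (by fun_prop))
  set Φ₁ := {z : ℝ × ℝ | z.2 ^ s ≤ z.1 ^ p}.indicator
      fun z => u z.1 ^ (1 - α / d) * v z.2 ^ (1 - (β + lam) / d) with hΦ₁
  set Φ₂ := {z : ℝ × ℝ | z.2 ^ p ≤ z.1 ^ s}.indicator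
      fun z => v z.1 ^ (1 - β / d) * u z.2 ^ (1 - (α + lam) / d) with hΦ₂
  rw [lintegral_lintegral_eq_layercake volume volume (measurable_rieszKernel d α β lam) hf hf0
    hg hg0]
  calc ∫⁻ a in Ioi (0 : ℝ), ∫⁻ b in Ioi (0 : ℝ),
        ∫⁻ x in {x | b < g x}, ∫⁻ y in {y | a < f y}, rieszKernel d α β lam x y
      ≤ ∫⁻ a in Ioi (0 : ℝ), ∫⁻ b in Ioi (0 : ℝ), (C₁ * Φ₁ (a, b) + C₂ * Φ₂ (b, a)) := by
        refine lintegral_mono fun a => lintegral_mono fun b => ?_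
        rcases le_total (b ^ s) (a ^ p) with hab | hab
        · refine le_add_of_le_of_nonneg ?_ bot_le
          rw [hΦ₁, indicator_of_mem (show (a, b) ∈ {z : ℝ × ℝ | z.2 ^ s ≤ z.1 ^ p} from hab)]
          exact h₁ {y | a < f y} {x | b < g x}
        · refine le_add_of_nonneg_of_le bot_le ?_
          rw [hΦ₂, indicator_of_mem (show (b, a) ∈ {z : ℝ × ℝ | z.2 ^ p ≤ z.1 ^ s} from hab),
            mul_comm (v _ ^ _)]
          exact h₂ {y | a < f y} {x | b < g x}
    _ = C₁ * (∫⁻ a in Ioi (0 : ℝ), ∫⁻ b in Ioi (0 : ℝ), Φ₁ (a, b)) +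
          C₂ * ∫⁻ b in Ioi (0 : ℝ), ∫⁻ a in Ioi (0 : ℝ), Φ₂ (b, a) := by
        have n₁ : ∀ a, Measurable fun b => Φ₁ (a, b) := fun a => m₁.comp measurable_prodMk_left
        have n₂ : ∀ a, Measurable fun b => Φ₂ (b, a) := fun a => m₂.comp measurable_prodMk_right
        simp_rw [lintegral_add_left ((n₁ _).const_mul C₁), lintegral_const_mul C₁ (n₁ _),
          lintegral_const_mul C₂ (n₂ _)]
        rw [lintegral_add_left (m₁.lintegral_prod_right'.const_mul C₁),
          lintegral_const_mul C₁ m₁.lintegral_prod_right',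
          lintegral_const_mul C₂ m₂.lintegral_prod_left',
          lintegral_lintegral_swap (f := fun a b => Φ₂ (b, a))]
        exact (m₂.comp measurable_swap).aemeasurable
    _ ≤ C₁ * ENNReal.ofReal ((κ / gapMinus d α p) ^ κ) +
          C₂ * ENNReal.ofReal ((κ / gapPlus d α lam p) ^ κ) := by gcongr
    _ ≤ _ := by
        rw [add_mul]
        gcongr
        · exact le_self_add
        · exact le_add_self

/-- Strong-type bound for the potential of the absolute value, with explicit dependence on the
distance of `1/p` from the two endpoints. -/
lemma exists_eLpNorm_lintegral_rieszKernel_le (d : ℕ) [NeZero d] {α β lam : ℝ} (hα : 0 ≤ α)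
    (hβ : 0 ≤ β) (hlam : 0 < lam) (hsum : α + β + lam < d) :
    ∃ C : ℝ≥0∞, C ≠ ∞ ∧ ∀ p q : ℝ, (p, q) ∈ rieszG d α β lam →
      p ∈ Set.Ioo (pMinus d α) (pPlus d α lam) →
      ∀ f : EuclideanSpace ℝ (Fin d) → ℝ, MemLp f (ENNReal.ofReal p) volume →
        eLpNorm (fun x => ∫⁻ y, ‖f y‖ₑ * rieszKernel d α β lam x y) (ENNReal.ofReal q) volume ≤
          C * (ENNReal.ofReal ((rieszKappa d α β lam / gapMinus d α p) ^ rieszKappa d α β lam) +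
            ENNReal.ofReal ((rieszKappa d α β lam / gapPlus d α lam p) ^ rieszKappa d α β lam)) *
            eLpNorm f (ENNReal.ofReal p) volume := by
  have hd : (0 : ℝ) < d := by exact_mod_cast NeZero.pos d
  obtain ⟨C, hC, hmain⟩ := exists_lintegral_mul_lintegral_rieszKernel_le d hα hβ hlam hsum
  refine ⟨C, hC, ?_⟩
  intro p q hG hp f hf
  have hp1 : 1 < p := (one_le_pMinus hα (by linarith)).trans_lt hp.1
  have hp0 : 0 < p := by linarith
  have hq1 : 1 < q := hp1.trans (lt_of_mem_rieszG hd hsum hG)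
  have hq0 : 0 < q := by linarith
  have hqs := Real.HolderConjugate.conjExponent hq1
  have hKm := measurable_rieszKernel d α β lam
  set K := rieszKernel d α β lam with hK
  set B := C * (ENNReal.ofReal ((rieszKappa d α β lam / gapMinus d α p) ^ rieszKappa d α β lam) +
    ENNReal.ofReal ((rieszKappa d α β lam / gapPlus d α lam p) ^ rieszKappa d α β lam)) with hB
  -- the estimate for nonnegative functions of norm one
  have hunit : ∀ g : EuclideanSpace ℝ (Fin d) → ℝ, Measurable g → (∀ x, 0 ≤ g x) →
      ∫⁻ x, ENNReal.ofReal (g x ^ p) ≤ 1 →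
      ∫⁻ x, (∫⁻ y, ENNReal.ofReal (g y) * K x y) ^ q ≤ B ^ q := by
    intro g hg hg0 hg1
    refine lintegral_rpow_le_of_forall_lintegral_mul_le hqs ?_ fun w hw hw0 hw1 =>
      hmain p q _ hG hp hqs g w hg hg0 hw hw0 hg1 hw1
    exact Measurable.lintegral_prod_right'
      (f := fun z : EuclideanSpace ℝ (Fin d) × EuclideanSpace ℝ (Fin d) =>
        ENNReal.ofReal (g z.2) * K z.1 z.2) (by fun_prop)
  set N := eLpNorm f (ENNReal.ofReal p) volume with hN
  have hNp : N = (∫⁻ x, ‖f x‖ₑ ^ p) ^ (1 / p) := by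
    rw [hN, eLpNorm_eq_lintegral_rpow_enorm_toReal (by simpa using hp0) ENNReal.ofReal_ne_top,
      ENNReal.toReal_ofReal hp0.le]
  have hNp' : ∫⁻ x, ‖f x‖ₑ ^ p = N ^ p := by
    rw [hNp, ← ENNReal.rpow_mul, one_div_mul_cancel hp0.ne', ENNReal.rpow_one]
  have hNtop : N ≠ ∞ := hf.2.ne
  rcases eq_or_ne N 0 with hN0 | hN0
  · have hf0 : f =ᵐ[volume] 0 := by
      rwa [hN, eLpNorm_eq_zero_iff hf.1 (by simpa using hp0)] at hN0
    have : (fun x => ∫⁻ y, ‖f y‖ₑ * K x y) = 0 := by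
      funext x
      rw [Pi.zero_apply, ← lintegral_zero (μ := (volume : Measure (EuclideanSpace ℝ (Fin d))))]
      refine lintegral_congr_ae (hf0.mono fun y hy => ?_)
      simp [hy]
    rw [this, eLpNorm_zero]
    exact bot_le
  have hf' := hf.1.ae_eq_mk
  have hfm : Measurable (hf.1.mk f) := hf.1.stronglyMeasurable_mk.measurable
  set f' := hf.1.mk f with hf'def
  set n := N.toReal with hn
  have hn0 : 0 < n := ENNReal.toReal_pos hN0 hNtop
  have hnN : ENNReal.ofReal n = N := ENNReal.ofReal_toReal hNtop
  set g : EuclideanSpace ℝ (Fin d) → ℝ := fun y => |f' y| / n with hg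
  have hgm : Measurable g := by fun_prop
  have hg0 : ∀ x, 0 ≤ g x := fun x => div_nonneg (abs_nonneg _) hn0.le
  have hge : ∀ y, ‖f' y‖ₑ = N * ENNReal.ofReal (g y) := by
    intro y
    rw [← hnN, ← ENNReal.ofReal_mul hn0.le, hg, mul_div_cancel₀ _ hn0.ne', ← Real.norm_eq_abs,
      ofReal_norm]
  have hg1 : ∫⁻ x, ENNReal.ofReal (g x ^ p) ≤ 1 := by
    have h1 : ∫⁻ x, ‖f x‖ₑ ^ p = N ^ p * ∫⁻ x, ENNReal.ofReal (g x ^ p) := by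
      rw [← lintegral_const_mul _ (by fun_prop)]
      refine lintegral_congr_ae (hf'.mono fun y hy => ?_)
      simp only
      rw [hy, hge, ENNReal.mul_rpow_of_nonneg _ _ hp0.le,
        ENNReal.ofReal_rpow_of_nonneg (hg0 y) hp0.le]
    rw [hNp'] at h1
    have hNp0 : N ^ p ≠ 0 := by simp [hN0, hNtop]
    have hNpt : N ^ p ≠ ∞ := ENNReal.rpow_ne_top_of_nonneg hp0.le hNtop
    refine le_of_eq ((ENNReal.mul_right_inj hNp0 hNpt).1 ?_)
    rw [← h1, mul_one]
  have hT : ∀ x, ∫⁻ y, ‖f y‖ₑ * K x y = N * ∫⁻ y, ENNReal.ofReal (g y) * K x y := by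
    intro x
    rw [← lintegral_const_mul' _ _ hNtop]
    refine lintegral_congr_ae (hf'.mono fun y hy => ?_)
    simp only
    rw [hy, hge, mul_assoc]
  simp only [hT]
  rw [eLpNorm_eq_lintegral_rpow_enorm_toReal (by simpa using hq0) ENNReal.ofReal_ne_top,
    ENNReal.toReal_ofReal hq0.le]
  simp only [enorm_eq_self, ENNReal.mul_rpow_of_nonneg _ _ hq0.le]
  rw [lintegral_const_mul' _ _ (ENNReal.rpow_ne_top_of_nonneg hq0.le hNtop)]
  calc (N ^ q * ∫⁻ x, (∫⁻ y, ENNReal.ofReal (g y) * K x y) ^ q) ^ (1 / q)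
      ≤ (N ^ q * B ^ q) ^ (1 / q) := by
        gcongr
        exact hunit g hgm hg0 hg1
    _ = B * N := by
        rw [← ENNReal.mul_rpow_of_nonneg _ _ hq0.le, ← ENNReal.rpow_mul,
          mul_one_div_cancel hq0.ne', ENNReal.rpow_one, mul_comm]

/-! ### The potential on `L^p` -/

lemma enorm_rpow_norm {d : ℕ} (x : EuclideanSpace ℝ (Fin d)) (e : ℝ) :
    ‖(‖x‖ ^ e : ℝ)‖ₑ = ENNReal.ofReal (‖x‖ ^ e) :=
  Real.enorm_of_nonneg (Real.rpow_nonneg (norm_nonneg _) _)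

lemma enorm_rieszIntegrand (d : ℕ) (α lam : ℝ) (f : EuclideanSpace ℝ (Fin d) → ℝ)
    (x y : EuclideanSpace ℝ (Fin d)) :
    ‖rieszIntegrand d α lam f x y‖ₑ =
      ‖f y‖ₑ * ENNReal.ofReal (‖y‖ ^ (-α) * ‖x - y‖ ^ (-lam)) := by
  rw [rieszIntegrand, div_eq_mul_inv, ← Real.rpow_neg (norm_nonneg _), mul_assoc, enorm_mul,
    Real.enorm_of_nonneg (mul_nonneg (Real.rpow_nonneg (norm_nonneg _) _)
      (Real.rpow_nonneg (norm_nonneg _) _))]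

lemma ofReal_mul_lintegral_enorm_rieszIntegrand (d : ℕ) (α β lam : ℝ)
    (f : EuclideanSpace ℝ (Fin d) → ℝ) (x : EuclideanSpace ℝ (Fin d)) :
    ENNReal.ofReal (‖x‖ ^ (-β)) * ∫⁻ y, ‖rieszIntegrand d α lam f x y‖ₑ =
      ∫⁻ y, ‖f y‖ₑ * rieszKernel d α β lam x y := by
  rw [← lintegral_const_mul' _ _ ENNReal.ofReal_ne_top]
  refine lintegral_congr fun y => ?_
  rw [enorm_rieszIntegrand, rieszKernel]
  ring

lemma enorm_weightedRiesz_le (d : ℕ) (α β lam : ℝ) (f : EuclideanSpace ℝ (Fin d) → ℝ)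
    (x : EuclideanSpace ℝ (Fin d)) :
    ‖weightedRiesz d α β lam f x‖ₑ ≤ ∫⁻ y, ‖f y‖ₑ * rieszKernel d α β lam x y := by
  rw [← ofReal_mul_lintegral_enorm_rieszIntegrand, weightedRiesz, enorm_mul, enorm_rpow_norm]
  gcongr
  exact enorm_integral_le_lintegral_enorm _

/-- For nonnegative `f` there is no cancellation; without integrability the left side would be the
junk value `0`. -/
lemma enorm_weightedRiesz_of_nonneg {d : ℕ} {α β lam : ℝ} {f : EuclideanSpace ℝ (Fin d) → ℝ}
    (hf : ∀ y, 0 ≤ f y) {x : EuclideanSpace ℝ (Fin d)}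
    (hx : Integrable (rieszIntegrand d α lam f x) volume) :
    ‖weightedRiesz d α β lam f x‖ₑ = ∫⁻ y, ‖f y‖ₑ * rieszKernel d α β lam x y := by
  have h0 : ∀ y, 0 ≤ rieszIntegrand d α lam f x y := fun y =>
    div_nonneg (mul_nonneg (hf y) (Real.rpow_nonneg (norm_nonneg _) _))
      (Real.rpow_nonneg (norm_nonneg _) _)
  rw [← ofReal_mul_lintegral_enorm_rieszIntegrand, weightedRiesz, enorm_mul, enorm_rpow_norm,
    Real.enorm_of_nonneg (integral_nonneg h0),
    ofReal_integral_eq_lintegral_ofReal hx (Filter.Eventually.of_forall h0)]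
  congr 1
  exact lintegral_congr fun y => (Real.enorm_of_nonneg (h0 y)).symm

lemma aestronglyMeasurable_rieszIntegrand {d : ℕ} {α lam : ℝ} {f : EuclideanSpace ℝ (Fin d) → ℝ}
    (hf : AEStronglyMeasurable f volume) (x : EuclideanSpace ℝ (Fin d)) :
    AEStronglyMeasurable (rieszIntegrand d α lam f x) volume := by
  unfold rieszIntegrand
  have h1 : Measurable fun y : EuclideanSpace ℝ (Fin d) => ‖y‖ ^ (-α) := by fun_prop
  have h2 : Measurable fun y : EuclideanSpace ℝ (Fin d) => ‖x - y‖ ^ lam := by fun_prop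
  simp only [div_eq_mul_inv]
  exact (hf.mul h1.aestronglyMeasurable).mul h2.inv.aestronglyMeasurable

lemma weightedRiesz_congr_ae {d : ℕ} {α β lam : ℝ} {f g : EuclideanSpace ℝ (Fin d) → ℝ}
    (h : f =ᵐ[volume] g) : weightedRiesz d α β lam f = weightedRiesz d α β lam g := by
  funext x
  unfold weightedRiesz rieszIntegrand
  congr 1
  exact integral_congr_ae (h.mono fun y hy => by simp only [hy])

lemma aestronglyMeasurable_weightedRiesz {d : ℕ} {α β lam : ℝ}
    {f : EuclideanSpace ℝ (Fin d) → ℝ} (hf : AEStronglyMeasurable f volume) :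
    AEStronglyMeasurable (weightedRiesz d α β lam f) volume := by
  rw [weightedRiesz_congr_ae hf.ae_eq_mk]
  have hm : Measurable (hf.mk f) := hf.stronglyMeasurable_mk.measurable
  unfold weightedRiesz rieszIntegrand
  refine AEStronglyMeasurable.mul (Measurable.aestronglyMeasurable (by fun_prop)) ?_
  exact (StronglyMeasurable.integral_prod_right' (ν := volume)
    (f := fun z : EuclideanSpace ℝ (Fin d) × EuclideanSpace ℝ (Fin d) =>
      hf.mk f z.2 * ‖z.2‖ ^ (-α) / ‖z.1 - z.2‖ ^ lam)
    (Measurable.stronglyMeasurable (by fun_prop))).aestronglyMeasurable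

section Bounded

variable {d : ℕ} {α β lam : ℝ}

lemma measurable_lintegral_enorm_mul_rieszKernel {f : EuclideanSpace ℝ (Fin d) → ℝ}
    (hf : AEStronglyMeasurable f volume) :
    Measurable fun x => ∫⁻ y, ‖f y‖ₑ * rieszKernel d α β lam x y := by
  have hm : Measurable (hf.mk f) := hf.stronglyMeasurable_mk.measurable
  have : (fun x => ∫⁻ y, ‖f y‖ₑ * rieszKernel d α β lam x y) =
      fun x => ∫⁻ y, ‖hf.mk f y‖ₑ * rieszKernel d α β lam x y := by
    funext x
    exact lintegral_congr_ae (hf.ae_eq_mk.mono fun y hy => by simp only; rw [hy])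
  rw [this]
  have hK := measurable_rieszKernel d α β lam
  exact Measurable.lintegral_prod_right'
    (f := fun z : EuclideanSpace ℝ (Fin d) × EuclideanSpace ℝ (Fin d) =>
      ‖hf.mk f z.2‖ₑ * rieszKernel d α β lam z.1 z.2)
    ((hm.comp measurable_snd).enorm.mul hK)

lemma eLpNorm_weightedRiesz_le_rieszV_mul {p q : ℝ}
    {f : EuclideanSpace ℝ (Fin d) → ℝ} (hf : f ∈ interLp d (pMinus d α) (pPlus d α lam))
    (hp : p ∈ Set.Ioo (pMinus d α) (pPlus d α lam)) (hp0 : 0 < p) :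
    eLpNorm (weightedRiesz d α β lam f) (ENNReal.ofReal q) volume ≤
      rieszV d α β lam p q * eLpNorm f (ENNReal.ofReal p) volume := by
  by_cases h0 : f =ᵐ[volume] 0
  · have : weightedRiesz d α β lam f = 0 := by
      rw [weightedRiesz_congr_ae h0]
      funext x
      simp [weightedRiesz, rieszIntegrand]
    rw [this, eLpNorm_zero]
    exact bot_le
  · have hfp := hf p hp
    have hne : eLpNorm f (ENNReal.ofReal p) volume ≠ 0 := by
      rwa [Ne, eLpNorm_eq_zero_iff hfp.1 (by simpa using hp0)]
    rw [← ENNReal.div_le_iff hne hfp.2.ne]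
    exact le_iSup₂ (f := fun f (_ : f ∈ {f ∈ interLp d (pMinus d α) (pPlus d α lam) |
      ¬ f =ᵐ[volume] 0}) => eLpNorm (weightedRiesz d α β lam f) (ENNReal.ofReal q) volume /
      eLpNorm f (ENNReal.ofReal p) volume) f ⟨hf, h0⟩

/-- Truncations of a function to bounded values and a bounded set lie in every `L^r`. -/
lemma memLp_indicator_truncation {f : EuclideanSpace ℝ (Fin d) → ℝ} (hf : Measurable f) (n : ℕ)
    (r : ℝ≥0∞) : MemLp ({y | ‖y‖ ≤ n ∧ |f y| ≤ n}.indicator f) r volume := by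
  have hS : MeasurableSet {y : EuclideanSpace ℝ (Fin d) | ‖y‖ ≤ n ∧ |f y| ≤ n} :=
    (measurableSet_le measurable_norm measurable_const).inter
      (measurableSet_le hf.norm measurable_const)
  rw [memLp_indicator_iff_restrict hS]
  have : IsFiniteMeasure ((volume : Measure (EuclideanSpace ℝ (Fin d))).restrict
      {y | ‖y‖ ≤ n ∧ |f y| ≤ n}) := by
    refine ⟨?_⟩
    rw [Measure.restrict_apply_univ]
    refine (measure_mono (t := Metric.closedBall 0 n) fun y hy => ?_).trans_lt
      measure_closedBall_lt_top
    simpa using hy.1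
  refine MemLp.of_bound hf.aestronglyMeasurable (n : ℝ) ?_
  filter_upwards [ae_restrict_mem hS] with y hy
  exact hy.2

variable [NeZero d]

lemma eLpNorm_lintegral_rieszKernel_lt_top (hα : 0 ≤ α) (hβ : 0 ≤ β) (hlam : 0 < lam)
    (hsum : α + β + lam < d) {p q : ℝ} (hG : (p, q) ∈ rieszG d α β lam)
    (hp : p ∈ Set.Ioo (pMinus d α) (pPlus d α lam)) {f : EuclideanSpace ℝ (Fin d) → ℝ}
    (hf : MemLp f (ENNReal.ofReal p) volume) :
    eLpNorm (fun x => ∫⁻ y, ‖f y‖ₑ * rieszKernel d α β lam x y) (ENNReal.ofReal q) volume < ∞ := by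
  obtain ⟨C, hC, h⟩ := exists_eLpNorm_lintegral_rieszKernel_le d hα hβ hlam hsum
  refine (h p q hG hp f hf).trans_lt ?_
  refine ENNReal.mul_lt_top (ENNReal.mul_lt_top hC.lt_top ?_) hf.2
  exact ENNReal.add_lt_top.2 ⟨ENNReal.ofReal_lt_top, ENNReal.ofReal_lt_top⟩

lemma ae_integrable_rieszIntegrand (hα : 0 ≤ α) (hβ : 0 ≤ β) (hlam : 0 < lam)
    (hsum : α + β + lam < d) {p q : ℝ} (hG : (p, q) ∈ rieszG d α β lam)
    (hp : p ∈ Set.Ioo (pMinus d α) (pPlus d α lam)) {f : EuclideanSpace ℝ (Fin d) → ℝ}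
    (hf : MemLp f (ENNReal.ofReal p) volume) :
    ∀ᵐ x ∂(volume : Measure (EuclideanSpace ℝ (Fin d))),
      Integrable (rieszIntegrand d α lam f x) volume := by
  have hq0 : 0 < q := hG.2.1
  have hlt := eLpNorm_lintegral_rieszKernel_lt_top hα hβ hlam hsum hG hp hf
  have hm := measurable_lintegral_enorm_mul_rieszKernel (α := α) (β := β) (lam := lam) hf.1
  have hint := lintegral_rpow_enorm_lt_top_of_eLpNorm_lt_top (by simpa using hq0)
    ENNReal.ofReal_ne_top hlt
  rw [ENNReal.toReal_ofReal hq0.le] at hint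
  have h1 := ae_lt_top (by fun_prop) hint.ne
  have h0 : ∀ᵐ x ∂(volume : Measure (EuclideanSpace ℝ (Fin d))), x ≠ 0 := Measure.ae_ne volume 0
  filter_upwards [h1, h0] with x hx hx0
  refine ⟨aestronglyMeasurable_rieszIntegrand hf.1 x, ?_⟩
  rw [enorm_eq_self, ENNReal.rpow_lt_top_iff_of_pos hq0,
    ← ofReal_mul_lintegral_enorm_rieszIntegrand] at hx
  -- off the origin the outer weight does not vanish, so the inner integral is finite
  have hpos : ENNReal.ofReal (‖x‖ ^ (-β)) ≠ 0 := by
    have : 0 < ‖x‖ := norm_pos_iff.2 hx0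
    have := Real.rpow_pos_of_pos this (-β)
    simpa using this
  exact ENNReal.lt_top_of_mul_ne_top_right hx.ne hpos

lemma memLp_weightedRiesz (hα : 0 ≤ α) (hβ : 0 ≤ β) (hlam : 0 < lam)
    (hsum : α + β + lam < d) {p q : ℝ} (hG : (p, q) ∈ rieszG d α β lam)
    (hp : p ∈ Set.Ioo (pMinus d α) (pPlus d α lam)) {f : EuclideanSpace ℝ (Fin d) → ℝ}
    (hf : MemLp f (ENNReal.ofReal p) volume) :
    MemLp (weightedRiesz d α β lam f) (ENNReal.ofReal q) volume :=
  ⟨aestronglyMeasurable_weightedRiesz hf.1,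
    (eLpNorm_mono_enorm fun x => (enorm_weightedRiesz_le d α β lam f x).trans_eq
      (enorm_eq_self _).symm).trans_lt
      (eLpNorm_lintegral_rieszKernel_lt_top hα hβ hlam hsum hG hp hf)⟩

open Filter Topology in
/-- The constant `V(p)`, defined by functions in all `L^r` with `p₋ < r < p₊`, works on all of
`L^p`: approximate by truncations and use Fatou's lemma. -/
lemma eLpNorm_weightedRiesz_le_rieszV_mul_of_memLp (hα : 0 ≤ α) (hβ : 0 ≤ β) (hlam : 0 < lam)
    (hsum : α + β + lam < d) {p q : ℝ} (hG : (p, q) ∈ rieszG d α β lam)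
    (hp : p ∈ Set.Ioo (pMinus d α) (pPlus d α lam)) {f : EuclideanSpace ℝ (Fin d) → ℝ}
    (hf : MemLp f (ENNReal.ofReal p) volume) :
    eLpNorm (weightedRiesz d α β lam f) (ENNReal.ofReal q) volume ≤
      rieszV d α β lam p q * eLpNorm f (ENNReal.ofReal p) volume := by
  wlog hfm : Measurable f generalizing f
  · obtain ⟨f', hf', hmk⟩ := hf.1
    rw [weightedRiesz_congr_ae hmk, eLpNorm_congr_ae hmk]
    exact this ((memLp_congr_ae hmk).1 hf) hf'.measurable
  set t : ℕ → EuclideanSpace ℝ (Fin d) → ℝ := fun n =>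
    {y | ‖y‖ ≤ n ∧ |f y| ≤ n}.indicator f with ht
  have htL : ∀ n r, MemLp (t n) r volume := fun n r => memLp_indicator_truncation hfm n r
  have hle : ∀ n y, ‖t n y‖ ≤ ‖f y‖ := fun n y => norm_indicator_le_norm_self _ _
  have hlim : ∀ y, ∀ᶠ n in atTop, t n y = f y := by
    intro y
    filter_upwards [eventually_ge_atTop ⌈max ‖y‖ |f y|⌉₊] with n hn
    have := Nat.ceil_le.1 hn
    exact Set.indicator_of_mem (s := {y | ‖y‖ ≤ n ∧ |f y| ≤ n})
      ⟨(le_max_left _ _).trans this, (le_max_right _ _).trans this⟩ f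
  have hconv : ∀ᵐ x ∂(volume : Measure (EuclideanSpace ℝ (Fin d))),
      Tendsto (fun n => weightedRiesz d α β lam (t n) x) atTop
        (𝓝 (weightedRiesz d α β lam f x)) := by
    filter_upwards [ae_integrable_rieszIntegrand hα hβ hlam hsum hG hp hf] with x hx
    refine Tendsto.const_mul _ ?_
    refine tendsto_integral_of_dominated_convergence (fun y => ‖rieszIntegrand d α lam f x y‖)
      (fun n => aestronglyMeasurable_rieszIntegrand (htL n 1).1 x) hx.norm ?_ ?_
    · intro n
      refine Eventually.of_forall fun y => ?_
      simp only [rieszIntegrand, norm_div, norm_mul]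
      gcongr
      exact hle n y
    · refine Eventually.of_forall fun y => ?_
      refine tendsto_const_nhds.congr' ((hlim y).mono fun n hn => ?_)
      simp only [rieszIntegrand, hn]
  refine (Lp.eLpNorm_lim_le_liminf_eLpNorm
    (fun n => aestronglyMeasurable_weightedRiesz (htL n 1).1) _ hconv).trans ?_
  refine (liminf_le_liminf (v := fun _ => rieszV d α β lam p q *
    eLpNorm f (ENNReal.ofReal p) volume) (Eventually.of_forall fun n => ?_)).trans_eq
    (liminf_const _)
  refine (eLpNorm_weightedRiesz_le_rieszV_mul (fun r _ => htL n _) hp hG.1).trans ?_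
  gcongr
  exact eLpNorm_mono (hle n)

end Bounded

/-! ### Lower bounds by test functions -/

/-- The ratio of the norms in both lower bounds: `s` is the area of the sphere, `D` the dimension,
and the powers of `δ` combine to `δ^{-κ}` through the scaling relation. -/
lemma test_function_norm_ratio_le {s δ κ D p q lam : ℝ} (hs : 0 < s) (hδ : 0 < δ)
    (hD : 1 ≤ D) (hp : 1 ≤ p) (hq : 0 < q) (h : 1 + 1 / q = 1 / p + κ) :
    (2 ^ (-lam) * s ^ κ * Real.exp (-(2 * D)) * δ ^ (-κ)) * (s * (1 / (p * D * δ))) ^ (1 / p) ≤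
      2 ^ (-lam) * s / δ * (s * (Real.exp (-(q * D)) / (q * D * δ))) ^ (1 / q) := by
  have hp0 : 0 < p := by linarith
  have hD0 : 0 < D := by linarith
  have h1 : (s * (1 / (p * D * δ))) ^ (1 / p) ≤ (s / δ) ^ (1 / p) := by
    refine Real.rpow_le_rpow (by positivity) ?_ (by positivity)
    rw [mul_one_div]
    exact div_le_div_of_nonneg_left hs.le hδ
      (le_mul_of_one_le_left hδ.le (one_le_mul_of_one_le_of_one_le hp hD))
  have h2 : (s / δ) ^ (1 / q) * Real.exp (-(2 * D)) ≤
      (s * (Real.exp (-(q * D)) / (q * D * δ))) ^ (1 / q) := by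
    have e1 : (s / δ) ^ (1 / q) * Real.exp (-(2 * D)) =
        (s / δ * Real.exp (-(2 * (q * D)))) ^ (1 / q) := by
      rw [Real.mul_rpow (by positivity) (by positivity), ← Real.exp_mul]
      congr 2
      field_simp
    rw [e1]
    refine Real.rpow_le_rpow (by positivity) ?_ (by positivity)
    -- the factor `q D` is absorbed by `exp (q D)`, uniformly in `q`
    have e2 : q * D * Real.exp (-(q * D)) ≤ 1 := by
      rw [Real.exp_neg, ← div_eq_mul_inv, div_le_one (Real.exp_pos _)]
      linarith [Real.add_one_le_exp (q * D)]
    have e3 : Real.exp (-(2 * (q * D))) = Real.exp (-(q * D)) * Real.exp (-(q * D)) := by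
      rw [← Real.exp_add]; congr 1; ring
    have e4 : s * (Real.exp (-(q * D)) / (q * D * δ)) =
        s / δ * (Real.exp (-(q * D)) * (q * D)⁻¹) := by field_simp
    rw [e3, e4]
    gcongr
    rwa [le_inv_comm₀ (by positivity) (by positivity), ← one_div, le_div_iff₀ (by positivity)]
  have e : s ^ κ * δ ^ (-κ) = (s / δ) ^ κ := by
    rw [Real.div_rpow hs.le hδ.le, Real.rpow_neg hδ.le, div_eq_mul_inv]
  have e' : (s / δ) ^ κ * (s / δ) ^ (1 / p) = s / δ * (s / δ) ^ (1 / q) := by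
    have hsd : 0 < s / δ := by positivity
    rw [← Real.rpow_add hsd, show κ + 1 / p = 1 + 1 / q by linarith, Real.rpow_add hsd,
      Real.rpow_one]
  calc _ ≤ (2 ^ (-lam) * s ^ κ * Real.exp (-(2 * D)) * δ ^ (-κ)) * (s / δ) ^ (1 / p) := by gcongr
    _ = 2 ^ (-lam) * Real.exp (-(2 * D)) * ((s ^ κ * δ ^ (-κ)) * (s / δ) ^ (1 / p)) := by ring
    _ = 2 ^ (-lam) * s / δ * ((s / δ) ^ (1 / q) * Real.exp (-(2 * D))) := by
        rw [e, e']; ring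
    _ ≤ _ := by gcongr

section Lower

variable {d : ℕ} {α β lam : ℝ}

lemma ofReal_rpow_norm_rpow (x : EuclideanSpace ℝ (Fin d)) {e r : ℝ} (hr : 0 ≤ r) :
    ENNReal.ofReal (‖x‖ ^ e) ^ r = ENNReal.ofReal (‖x‖ ^ (e * r)) := by
  rw [ENNReal.ofReal_rpow_of_nonneg (Real.rpow_nonneg (norm_nonneg _) _) hr,
    ← Real.rpow_mul (norm_nonneg _)]

lemma lintegral_enorm_indicator_rpow_norm {S : Set (EuclideanSpace ℝ (Fin d))}
    (hS : MeasurableSet S) {e r : ℝ} (hr : 0 < r) :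
    ∫⁻ y, ‖S.indicator (fun y => ‖y‖ ^ e) y‖ₑ ^ r =
      ∫⁻ y in S, ENNReal.ofReal (‖y‖ ^ (e * r)) := by
  rw [← lintegral_indicator hS]
  refine lintegral_congr fun y => ?_
  by_cases hy : y ∈ S
  · rw [Set.indicator_of_mem hy, Set.indicator_of_mem hy, enorm_rpow_norm,
      ofReal_rpow_norm_rpow y hr.le]
  · simp [hy, hr]

lemma memLp_indicator_rpow_norm {S : Set (EuclideanSpace ℝ (Fin d))} (hS : MeasurableSet S)
    {e r : ℝ} (hr : 0 < r) (h : ∫⁻ y in S, ENNReal.ofReal (‖y‖ ^ (e * r)) < ∞) :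
    MemLp (S.indicator fun y => ‖y‖ ^ e) (ENNReal.ofReal r) volume := by
  have hm : Measurable fun y : EuclideanSpace ℝ (Fin d) => ‖y‖ ^ e := by fun_prop
  refine ⟨(hm.indicator hS).aestronglyMeasurable, ?_⟩
  rw [eLpNorm_lt_top_iff_lintegral_rpow_enorm_lt_top (by simpa using hr) ENNReal.ofReal_ne_top,
    ENNReal.toReal_ofReal hr.le, lintegral_enorm_indicator_rpow_norm hS hr]
  exact h

lemma rpow_norm_mul_two_le_rpow_norm_sub {x y z : EuclideanSpace ℝ (Fin d)} (hlam : 0 < lam)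
    (hxy : x ≠ y) (hx : ‖x‖ ≤ ‖z‖) (hy : ‖y‖ ≤ ‖z‖) :
    2 ^ (-lam) * ‖z‖ ^ (-lam) ≤ ‖x - y‖ ^ (-lam) := by
  rw [← Real.mul_rpow (by norm_num) (norm_nonneg _)]
  refine Real.rpow_le_rpow_of_nonpos (norm_pos_iff.2 (sub_ne_zero.2 hxy)) ?_ (by linarith)
  linarith [norm_sub_le x y]

variable [NeZero d]

/-- A nonnegative test function `f` whose potential is at least `2^{-λ} σ |x|^e / δ` on a set `S`
bounds `V(p)` from below by a multiple of `δ^{-κ}`. -/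
lemma ofReal_le_rieszV_of_test_function (hα : 0 ≤ α) (hβ : 0 ≤ β) (hlam : 0 < lam)
    (hsum : α + β + lam < d) {p q : ℝ} (hG : (p, q) ∈ rieszG d α β lam)
    (hp : p ∈ Set.Ioo (pMinus d α) (pPlus d α lam)) {f : EuclideanSpace ℝ (Fin d) → ℝ}
    (hf : f ∈ interLp d (pMinus d α) (pPlus d α lam)) (hf0 : ∀ y, 0 ≤ f y) {δ e : ℝ} (hδ : 0 < δ)
    {S : Set (EuclideanSpace ℝ (Fin d))} (hS : MeasurableSet S)
    (hN : ∫⁻ y, ‖f y‖ₑ ^ p = sphereArea d * ENNReal.ofReal (1 / (p * d * δ)))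
    (hSint : ∫⁻ x in S, ENNReal.ofReal (‖x‖ ^ e) ^ q =
      sphereArea d * ENNReal.ofReal (Real.exp (-(q * d)) / (q * d * δ)))
    (hT : ∀ x ∈ S, x ≠ 0 →
      ENNReal.ofReal (2 ^ (-lam) / δ) * sphereArea d * ENNReal.ofReal (‖x‖ ^ e) ≤
        ∫⁻ y, ‖f y‖ₑ * rieszKernel d α β lam x y) :
    ENNReal.ofReal (2 ^ (-lam) * (sphereArea d).toReal ^ rieszKappa d α β lam *
      Real.exp (-(2 * d)) * δ ^ (-rieszKappa d α β lam)) ≤ rieszV d α β lam p q := by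
  have hd1 : (1 : ℝ) ≤ d := by exact_mod_cast NeZero.one_le (n := d)
  have hp1 : 1 < p := (one_le_pMinus hα (by linarith)).trans_lt hp.1
  have hp0 : 0 < p := by linarith
  have hq0 : 0 < q := hG.2.1
  set s := (sphereArea d).toReal with hs
  have hs0 : 0 < s := ENNReal.toReal_pos (sphereArea_ne_zero d) (sphereArea_ne_top d)
  have hss : sphereArea d = ENNReal.ofReal s := (ENNReal.ofReal_toReal (sphereArea_ne_top d)).symm
  have hnorm : eLpNorm f (ENNReal.ofReal p) volume =
      ENNReal.ofReal ((s * (1 / (p * d * δ))) ^ (1 / p)) := by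
    rw [eLpNorm_eq_lintegral_rpow_enorm_toReal (by simpa using hp0) ENNReal.ofReal_ne_top,
      ENNReal.toReal_ofReal hp0.le, hN, hss, ← ENNReal.ofReal_mul hs0.le,
      ENNReal.ofReal_rpow_of_pos (by positivity)]
  have hpot : ENNReal.ofReal
      (2 ^ (-lam) * s / δ * (s * (Real.exp (-(q * d)) / (q * d * δ))) ^ (1 / q)) ≤
      eLpNorm (weightedRiesz d α β lam f) (ENNReal.ofReal q) volume := by
    have h0 : ∀ᵐ x ∂(volume : Measure (EuclideanSpace ℝ (Fin d))), x ≠ 0 :=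
      Measure.ae_ne volume 0
    rw [eLpNorm_eq_lintegral_rpow_enorm_toReal (by simpa using hq0) ENNReal.ofReal_ne_top,
      ENNReal.toReal_ofReal hq0.le]
    have hc : ENNReal.ofReal (2 ^ (-lam) / δ) * sphereArea d =
        ENNReal.ofReal (2 ^ (-lam) * s / δ) := by
      rw [hss, ← ENNReal.ofReal_mul (by positivity)]; congr 1; ring
    have hlow : ENNReal.ofReal (2 ^ (-lam) * s / δ) ^ q *
        ENNReal.ofReal (s * (Real.exp (-(q * d)) / (q * d * δ))) ≤
        ∫⁻ x, ‖weightedRiesz d α β lam f x‖ₑ ^ q := by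
      rw [ENNReal.ofReal_mul hs0.le, ← hss, ← hSint,
        ← lintegral_const_mul' _ _ (ENNReal.rpow_ne_top_of_nonneg hq0.le ENNReal.ofReal_ne_top)]
      refine le_trans (setLIntegral_mono_ae' hS ?_) (setLIntegral_le_lintegral S _)
      filter_upwards [ae_integrable_rieszIntegrand hα hβ hlam hsum hG hp (hf p hp), h0]
        with x hx hx0 hxS
      rw [enorm_weightedRiesz_of_nonneg hf0 hx, ← ENNReal.mul_rpow_of_nonneg _ _ hq0.le, ← hc]
      exact ENNReal.rpow_le_rpow (hT x hxS hx0) hq0.le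
    refine le_trans (le_of_eq ?_) (ENNReal.rpow_le_rpow hlow (by positivity : 0 ≤ 1 / q))
    rw [ENNReal.mul_rpow_of_nonneg _ _ (by positivity), ← ENNReal.rpow_mul,
      mul_one_div_cancel hq0.ne', ENNReal.rpow_one, ENNReal.ofReal_mul (by positivity),
      ENNReal.ofReal_rpow_of_pos (by positivity)]
  have hle := hpot.trans (eLpNorm_weightedRiesz_le_rieszV_mul (α := α) (β := β) (lam := lam)
    (q := q) hf hp hp0)
  have hnpos : 0 < (s * (1 / (p * d * δ))) ^ (1 / p) := by positivity
  rw [hnorm] at hle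
  have hne : ENNReal.ofReal ((s * (1 / (p * d * δ))) ^ (1 / p)) ≠ 0 := by
    simpa using hnpos
  rw [← ENNReal.mul_le_mul_iff_left hne ENNReal.ofReal_ne_top]
  refine le_trans ?_ hle
  rw [← ENNReal.ofReal_mul (by positivity)]
  exact ENNReal.ofReal_le_ofReal
    (test_function_norm_ratio_le hs0 hδ hd1 hp1.le hq0 hG.2.2)

/-- Lower bound by the test function `|y|^{-d/p₋}` on `|y| > 1`. -/
lemma ofReal_gapMinus_le_rieszV (hα : 0 ≤ α) (hβ : 0 ≤ β) (hlam : 0 < lam)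
    (hsum : α + β + lam < d) {p q : ℝ} (hG : (p, q) ∈ rieszG d α β lam)
    (hp : p ∈ Set.Ioo (pMinus d α) (pPlus d α lam)) :
    ENNReal.ofReal (2 ^ (-lam) * (sphereArea d).toReal ^ rieszKappa d α β lam *
      Real.exp (-(2 * d)) * gapMinus d α p ^ (-rieszKappa d α β lam)) ≤ rieszV d α β lam p q := by
  have hd : (0 : ℝ) < d := by exact_mod_cast NeZero.pos d
  have hp0 : 0 < p := hG.1
  have hq0 : 0 < q := hG.2.1
  have hδ : 0 < gapMinus d α p := gapMinus_pos hα (by linarith) hp.1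
  have hδq := gapMinus_eq_of_mem_rieszG hG
  have hA : MeasurableSet {y : EuclideanSpace ℝ (Fin d) | 1 < ‖y‖} :=
    measurableSet_lt measurable_const measurable_norm
  have hint : ∀ r, 0 < r → 0 < gapMinus d α r →
      ∫⁻ y in {y : EuclideanSpace ℝ (Fin d) | 1 < ‖y‖}, ENNReal.ofReal (‖y‖ ^ (-(d - α) * r)) =
        sphereArea d * ENNReal.ofReal (1 / (r * d * gapMinus d α r)) := by
    intro r hr hgr
    have := setLIntegral_compl_ball_norm_rpow d (m := r * d * gapMinus d α r) (R := 1)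
      (by positivity) one_pos
    rw [Real.one_rpow] at this
    rw [← this, show -((d : ℝ) - α) * r = -(r * d * gapMinus d α r) - d by
      rw [gapMinus]; field_simp; ring]
  -- beyond this radius the logarithmic growth of the potential has reached `1 / δ`
  set R := Real.exp (1 / gapMinus d α p) with hR
  have hR1 : 1 < R := Real.one_lt_exp_iff.2 (by positivity)
  refine ofReal_le_rieszV_of_test_function hα hβ hlam hsum hG hp
    (f := {y : EuclideanSpace ℝ (Fin d) | 1 < ‖y‖}.indicator fun y => ‖y‖ ^ (-((d : ℝ) - α)))
    (e := -(β + lam)) (S := {x | R < ‖x‖}) ?_ ?_ hδ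
    (measurableSet_lt measurable_const measurable_norm) ?_ ?_ ?_
  · intro r hr
    have hr0 : 0 < r := by linarith [one_le_pMinus (d := d) hα (by linarith), hr.1]
    refine memLp_indicator_rpow_norm hA hr0 ?_
    rw [hint r hr0 (gapMinus_pos hα (by linarith) hr.1)]
    exact ENNReal.mul_lt_top (sphereArea_ne_top d).lt_top ENNReal.ofReal_lt_top
  · exact fun y => Set.indicator_nonneg (fun y _ => Real.rpow_nonneg (norm_nonneg _) _) y
  · rw [lintegral_enorm_indicator_rpow_norm hA hp0, hint p hp0 hδ]
  · have := setLIntegral_compl_ball_norm_rpow d (m := q * d * gapMinus d α p) (R := R)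
      (by positivity) (by linarith)
    rw [hR, ← Real.exp_mul, show 1 / gapMinus d α p * -(q * d * gapMinus d α p) = -(q * d) by
      field_simp, ← hR] at this
    rw [← this]
    simp only [ofReal_rpow_norm_rpow _ hq0.le]
    rw [show -(β + lam) * q = -(q * d * gapMinus d α p) - d by
      rw [hδq]; field_simp; ring]
  · intro x (hx : R < ‖x‖) hx0
    have hann := setLIntegral_annulus_norm_rpow d one_pos hR1.le
    rw [div_one, hR, Real.log_exp, ← hR] at hann
    have hAnn : MeasurableSet {y : EuclideanSpace ℝ (Fin d) | ‖y‖ ∈ Set.Ioo 1 R} :=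
      measurable_norm measurableSet_Ioo
    have hxpos : 0 < ‖x‖ := norm_pos_iff.2 hx0
    calc ENNReal.ofReal (2 ^ (-lam) / gapMinus d α p) * sphereArea d *
          ENNReal.ofReal (‖x‖ ^ (-(β + lam)))
        = ENNReal.ofReal (2 ^ (-lam) * ‖x‖ ^ (-(β + lam))) *
            (sphereArea d * ENNReal.ofReal (1 / gapMinus d α p)) := by
          rw [div_eq_mul_one_div, ENNReal.ofReal_mul (by positivity),
            ENNReal.ofReal_mul (by positivity)]
          ring
      _ = ∫⁻ y in {y : EuclideanSpace ℝ (Fin d) | ‖y‖ ∈ Set.Ioo 1 R},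
            ENNReal.ofReal (2 ^ (-lam) * ‖x‖ ^ (-(β + lam))) *
              ENNReal.ofReal (‖y‖ ^ (-(d : ℝ))) := by
          rw [← hann, lintegral_const_mul' _ _ ENNReal.ofReal_ne_top]
      _ ≤ ∫⁻ y in {y : EuclideanSpace ℝ (Fin d) | ‖y‖ ∈ Set.Ioo 1 R},
            ‖{y : EuclideanSpace ℝ (Fin d) | 1 < ‖y‖}.indicator
              (fun y => ‖y‖ ^ (-((d : ℝ) - α))) y‖ₑ * rieszKernel d α β lam x y := by
          refine setLIntegral_mono' hAnn fun y (hy : ‖y‖ ∈ Set.Ioo 1 R) => ?_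
          have hy0 : 0 < ‖y‖ := by linarith [hy.1]
          rw [Set.indicator_of_mem (show y ∈ {y : EuclideanSpace ℝ (Fin d) | 1 < ‖y‖} from hy.1),
            enorm_rpow_norm, rieszKernel, ← ENNReal.ofReal_mul (by positivity),
            ← ENNReal.ofReal_mul (by positivity), ← ENNReal.ofReal_mul (by positivity)]
          refine ENNReal.ofReal_le_ofReal ?_
          have hker := rpow_norm_mul_two_le_rpow_norm_sub (x := x) (y := y) (z := x) hlam
            (by rintro rfl; linarith [hy.2]) le_rfl (hy.2.trans hx).le
          calc 2 ^ (-lam) * ‖x‖ ^ (-(β + lam)) * ‖y‖ ^ (-(d : ℝ))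
              = ‖y‖ ^ (-((d : ℝ) - α)) * (‖x‖ ^ (-β) * (‖y‖ ^ (-α) *
                  (2 ^ (-lam) * ‖x‖ ^ (-lam)))) := by
                rw [neg_add, Real.rpow_add hxpos,
                  show -(d : ℝ) = -((d : ℝ) - α) + -α by ring, Real.rpow_add hy0]
                ring
            _ ≤ _ := by gcongr
      _ ≤ _ := setLIntegral_le_lintegral _ _

/-- Lower bound by the test function `|y|^{-d/p₊}` on `|y| < 1`. -/
lemma ofReal_gapPlus_le_rieszV (hα : 0 ≤ α) (hβ : 0 ≤ β) (hlam : 0 < lam)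
    (hsum : α + β + lam < d) {p q : ℝ} (hG : (p, q) ∈ rieszG d α β lam)
    (hp : p ∈ Set.Ioo (pMinus d α) (pPlus d α lam)) :
    ENNReal.ofReal (2 ^ (-lam) * (sphereArea d).toReal ^ rieszKappa d α β lam *
      Real.exp (-(2 * d)) * gapPlus d α lam p ^ (-rieszKappa d α β lam)) ≤
      rieszV d α β lam p q := by
  have hd : (0 : ℝ) < d := by exact_mod_cast NeZero.pos d
  have hp0 : 0 < p := hG.1
  have hq0 : 0 < q := hG.2.1
  have hδ : 0 < gapPlus d α lam p := gapPlus_pos (by linarith) hd hp0 hp.2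
  have hδq := gapPlus_eq_of_mem_rieszG hG
  have hA : MeasurableSet {y : EuclideanSpace ℝ (Fin d) | ‖y‖ < 1} :=
    measurableSet_lt measurable_norm measurable_const
  have hint : ∀ r, 0 < r → 0 < gapPlus d α lam r →
      ∫⁻ y in {y : EuclideanSpace ℝ (Fin d) | ‖y‖ < 1},
          ENNReal.ofReal (‖y‖ ^ (-(d - α - lam) * r)) =
        sphereArea d * ENNReal.ofReal (1 / (r * d * gapPlus d α lam r)) := by
    intro r hr hgr
    have := setLIntegral_ball_norm_rpow d (m := r * d * gapPlus d α lam r) (R := 1)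
      (by positivity) zero_le_one
    rw [Real.one_rpow] at this
    rw [← this, show -((d : ℝ) - α - lam) * r = r * d * gapPlus d α lam r - d by
      rw [gapPlus]; field_simp; ring]
  -- inside this radius the logarithmic growth of the potential has reached `1 / δ`
  set R := Real.exp (-(1 / gapPlus d α lam p)) with hR
  have hR0 : 0 < R := Real.exp_pos _
  have hR1 : R < 1 := Real.exp_lt_one_iff.2 (neg_lt_zero.2 (by positivity))
  refine ofReal_le_rieszV_of_test_function hα hβ hlam hsum hG hp
    (f := {y : EuclideanSpace ℝ (Fin d) | ‖y‖ < 1}.indicator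
      fun y => ‖y‖ ^ (-((d : ℝ) - α - lam)))
    (e := -β) (S := {x | ‖x‖ < R}) ?_ ?_ hδ
    (measurableSet_lt measurable_norm measurable_const) ?_ ?_ ?_
  · intro r hr
    have hr0 : 0 < r := by linarith [one_le_pMinus (d := d) hα (by linarith), hr.1]
    refine memLp_indicator_rpow_norm hA hr0 ?_
    rw [hint r hr0 (gapPlus_pos (by linarith) hd hr0 hr.2)]
    exact ENNReal.mul_lt_top (sphereArea_ne_top d).lt_top ENNReal.ofReal_lt_top
  · exact fun y => Set.indicator_nonneg (fun y _ => Real.rpow_nonneg (norm_nonneg _) _) y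
  · rw [lintegral_enorm_indicator_rpow_norm hA hp0, hint p hp0 hδ]
  · have := setLIntegral_ball_norm_rpow d (m := q * d * gapPlus d α lam p) (R := R)
      (by positivity) hR0.le
    rw [hR, ← Real.exp_mul, show -(1 / gapPlus d α lam p) * (q * d * gapPlus d α lam p) = -(q * d)
      by field_simp, ← hR] at this
    rw [← this]
    simp only [ofReal_rpow_norm_rpow _ hq0.le]
    rw [show -β * q = q * d * gapPlus d α lam p - d by
      rw [hδq]; field_simp; ring]
  · intro x (hx : ‖x‖ < R) hx0
    have hann := setLIntegral_annulus_norm_rpow d hR0 hR1.le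
    rw [one_div, hR, ← Real.exp_neg, neg_neg, Real.log_exp, ← hR] at hann
    have hAnn : MeasurableSet {y : EuclideanSpace ℝ (Fin d) | ‖y‖ ∈ Set.Ioo R 1} :=
      measurable_norm measurableSet_Ioo
    have hxpos : 0 < ‖x‖ := norm_pos_iff.2 hx0
    calc ENNReal.ofReal (2 ^ (-lam) / gapPlus d α lam p) * sphereArea d *
          ENNReal.ofReal (‖x‖ ^ (-β))
        = ENNReal.ofReal (2 ^ (-lam) * ‖x‖ ^ (-β)) *
            (sphereArea d * ENNReal.ofReal (1 / gapPlus d α lam p)) := by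
          rw [div_eq_mul_one_div, ENNReal.ofReal_mul (by positivity),
            ENNReal.ofReal_mul (by positivity)]
          ring
      _ = ∫⁻ y in {y : EuclideanSpace ℝ (Fin d) | ‖y‖ ∈ Set.Ioo R 1},
            ENNReal.ofReal (2 ^ (-lam) * ‖x‖ ^ (-β)) * ENNReal.ofReal (‖y‖ ^ (-(d : ℝ))) := by
          rw [← hann, lintegral_const_mul' _ _ ENNReal.ofReal_ne_top]
      _ ≤ ∫⁻ y in {y : EuclideanSpace ℝ (Fin d) | ‖y‖ ∈ Set.Ioo R 1},
            ‖{y : EuclideanSpace ℝ (Fin d) | ‖y‖ < 1}.indicator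
              (fun y => ‖y‖ ^ (-((d : ℝ) - α - lam))) y‖ₑ * rieszKernel d α β lam x y := by
          refine setLIntegral_mono' hAnn fun y (hy : ‖y‖ ∈ Set.Ioo R 1) => ?_
          have hy0 : 0 < ‖y‖ := by linarith [hy.1]
          rw [Set.indicator_of_mem (show y ∈ {y : EuclideanSpace ℝ (Fin d) | ‖y‖ < 1} from hy.2),
            enorm_rpow_norm, rieszKernel, ← ENNReal.ofReal_mul (by positivity),
            ← ENNReal.ofReal_mul (by positivity), ← ENNReal.ofReal_mul (by positivity)]
          refine ENNReal.ofReal_le_ofReal ?_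
          have hker := rpow_norm_mul_two_le_rpow_norm_sub (x := x) (y := y) (z := y) hlam
            (by rintro rfl; linarith [hy.1]) (hx.trans hy.1).le le_rfl
          calc 2 ^ (-lam) * ‖x‖ ^ (-β) * ‖y‖ ^ (-(d : ℝ))
              = ‖y‖ ^ (-((d : ℝ) - α - lam)) * (‖x‖ ^ (-β) * (‖y‖ ^ (-α) *
                  (2 ^ (-lam) * ‖y‖ ^ (-lam)))) := by
                rw [show -(d : ℝ) = -((d : ℝ) - α - lam) + -α + -lam by ring,
                  Real.rpow_add hy0, Real.rpow_add hy0]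
                ring
            _ ≤ _ := by gcongr
      _ ≤ _ := setLIntegral_le_lintegral _ _

end Lower

/-! ### The two-sided estimate -/

section Comparison

variable {d : ℕ} {α lam p : ℝ}

lemma sub_mul_sub_eq_gap_mul (hα : 0 ≤ α) (hlam : 0 < lam) (hαd : α + lam < d)
    (hp : p ∈ Set.Ioo (pMinus d α) (pPlus d α lam)) :
    (p - pMinus d α) * (pPlus d α lam - p) =
      gapMinus d α p * gapPlus d α lam p * (p * pMinus d α * (p * pPlus d α lam)) := by
  have h1 := one_le_pMinus (d := d) hα (by linarith)
  have hp0 : 0 < p := by linarith [hp.1]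
  have hpp : 0 < pPlus d α lam := by linarith [hp.2]
  rw [gapMinus_eq hα (by linarith) hp.1, gapPlus_eq hαd (by linarith) hp0]
  field_simp

lemma gapMinus_add_gapPlus : gapMinus d α p + gapPlus d α lam p = lam / d := by
  rw [gapMinus, gapPlus]; ring

/-- The product of the distances of `p` from the endpoints is comparable to the smaller of the
two gaps `1/p₋ - 1/p` and `1/p - 1/p₊`, whose sum is `λ/d`. -/
lemma min_gap_mul_le_sub_mul_sub (hα : 0 ≤ α) (hlam : 0 < lam) (hαd : α + lam < d)
    (hp : p ∈ Set.Ioo (pMinus d α) (pPlus d α lam)) :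
    min (gapMinus d α p) (gapPlus d α lam p) * (lam / d / 2) ≤
      (p - pMinus d α) * (pPlus d α lam - p) := by
  have h1 := one_le_pMinus (d := d) hα (by linarith)
  have hd : (0 : ℝ) < d := by linarith
  have hp1 : 1 ≤ p := by linarith [hp.1]
  have hpp : 1 ≤ pPlus d α lam := by linarith [hp.2]
  have g1 := gapMinus_pos hα (by linarith) hp.1
  have g2 := gapPlus_pos hαd hd (by linarith) hp.2
  have hs := gapMinus_add_gapPlus (d := d) (α := α) (lam := lam) (p := p)
  rw [sub_mul_sub_eq_gap_mul hα hlam hαd hp]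
  have hone : 1 ≤ p * pMinus d α * (p * pPlus d α lam) :=
    one_le_mul_of_one_le_of_one_le (one_le_mul_of_one_le_of_one_le hp1 h1)
      (one_le_mul_of_one_le_of_one_le hp1 hpp)
  refine le_trans ?_ (le_mul_of_one_le_right (by positivity) hone)
  rw [← min_mul_max (gapMinus d α p) (gapPlus d α lam p)]
  gcongr
  have := le_max_left (gapMinus d α p) (gapPlus d α lam p)
  have := le_max_right (gapMinus d α p) (gapPlus d α lam p)
  linarith

lemma sub_mul_sub_le_min_gap_mul (hα : 0 ≤ α) (hlam : 0 < lam) (hαd : α + lam < d)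
    (hp : p ∈ Set.Ioo (pMinus d α) (pPlus d α lam)) :
    (p - pMinus d α) * (pPlus d α lam - p) ≤
      min (gapMinus d α p) (gapPlus d α lam p) * (lam / d * pPlus d α lam ^ 4) := by
  have h1 := one_le_pMinus (d := d) hα (by linarith)
  have hd : (0 : ℝ) < d := by linarith
  have hp1 : 1 ≤ p := by linarith [hp.1]
  have hpp : 1 ≤ pPlus d α lam := by linarith [hp.2]
  have g1 := gapMinus_pos hα (by linarith) hp.1
  have g2 := gapPlus_pos hαd hd (by linarith) hp.2
  have hs := gapMinus_add_gapPlus (d := d) (α := α) (lam := lam) (p := p)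
  have hmin : 0 < min (gapMinus d α p) (gapPlus d α lam p) := lt_min g1 g2
  rw [sub_mul_sub_eq_gap_mul hα hlam hαd hp, ← min_mul_max (gapMinus d α p) (gapPlus d α lam p),
    mul_assoc]
  have hmax : max (gapMinus d α p) (gapPlus d α lam p) ≤ lam / d :=
    max_le (by linarith) (by linarith)
  have hpow : p * pMinus d α * (p * pPlus d α lam) ≤ pPlus d α lam ^ 4 := by
    calc p * pMinus d α * (p * pPlus d α lam)
        ≤ pPlus d α lam * pPlus d α lam * (pPlus d α lam * pPlus d α lam) := by
          have := hp.1
          have := hp.2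
          gcongr
          linarith
      _ = _ := by ring
  gcongr

end Comparison

theorem theorem1 (d : ℕ) (hd : 1 ≤ d) (α β lam : ℝ) (hα : 0 ≤ α) (hβ : 0 ≤ β)
    (hlam : 0 < lam) (hsum : α + β + lam < d) :
    (∃ C₁ C₂ : ℝ, 0 < C₁ ∧ 0 < C₂ ∧
      ∀ p q : ℝ, (p, q) ∈ rieszG d α β lam → p ∈ Set.Ioo (pMinus d α) (pPlus d α lam) →
        ENNReal.ofReal
            (C₁ / ((p - pMinus d α) * (pPlus d α lam - p)) ^ rieszKappa d α β lam)
          ≤ rieszV d α β lam p q ∧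
        rieszV d α β lam p q
          ≤ ENNReal.ofReal
            (C₂ / ((p - pMinus d α) * (pPlus d α lam - p)) ^ rieszKappa d α β lam)) ∧
    -- the potential is well defined on `L_p`, and the supremum is the constant for all of `L_p`
    (∀ p q : ℝ, (p, q) ∈ rieszG d α β lam → p ∈ Set.Ioo (pMinus d α) (pPlus d α lam) →
      ∀ f : EuclideanSpace ℝ (Fin d) → ℝ, MemLp f (ENNReal.ofReal p) volume →
        (∀ᵐ x ∂(volume : Measure (EuclideanSpace ℝ (Fin d))),
          Integrable (rieszIntegrand d α lam f x) volume) ∧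
        MemLp (weightedRiesz d α β lam f) (ENNReal.ofReal q) volume ∧
        eLpNorm (weightedRiesz d α β lam f) (ENNReal.ofReal q) volume
          ≤ rieszV d α β lam p q * eLpNorm f (ENNReal.ofReal p) volume) := by
  have : NeZero d := ⟨by omega⟩
  have hd0 : (0 : ℝ) < d := by linarith
  refine ⟨?_, fun p q hG hp f hf => ⟨ae_integrable_rieszIntegrand hα hβ hlam hsum hG hp hf,
    memLp_weightedRiesz hα hβ hlam hsum hG hp hf,
    eLpNorm_weightedRiesz_le_rieszV_mul_of_memLp hα hβ hlam hsum hG hp hf⟩⟩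
  obtain ⟨C, hC, hup⟩ := exists_eLpNorm_lintegral_rieszKernel_le d hα hβ hlam hsum
  have hαd : α + lam < d := by linarith
  have hpP0 : 0 < pPlus d α lam := div_pos hd0 (by linarith)
  have hκ0 : 0 < rieszKappa d α β lam := div_pos (by linarith) hd0
  set κ := rieszKappa d α β lam with hκ
  have hσ : 0 < (sphereArea d).toReal :=
    ENNReal.toReal_pos (sphereArea_ne_zero d) (sphereArea_ne_top d)
  set c := 2 ^ (-lam) * (sphereArea d).toReal ^ κ * Real.exp (-(2 * d)) with hc
  have hc0 : 0 < c := by positivity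
  have hL : 0 < lam / d := by positivity
  set W := (κ * (lam / d * pPlus d α lam ^ 4)) ^ κ with hW
  have hW0 : 0 < W := by positivity
  refine ⟨c * (lam / d / 2) ^ κ, 2 * (C.toReal + 1) * W, by positivity, by positivity, ?_⟩
  intro p q hG hp
  have hp0 : 0 < p := hG.1
  have hδ₁ := gapMinus_pos hα (by linarith) hp.1
  have hδ₂ := gapPlus_pos hαd hd0 hp0 hp.2
  have hlow := min_gap_mul_le_sub_mul_sub hα hlam hαd hp
  have hupp := sub_mul_sub_le_min_gap_mul hα hlam hαd hp
  have hX : 0 < (p - pMinus d α) * (pPlus d α lam - p) :=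
    mul_pos (sub_pos.2 hp.1) (sub_pos.2 hp.2)
  set X := (p - pMinus d α) * (pPlus d α lam - p) with hXdef
  constructor
  · have hmin : ENNReal.ofReal (c * min (gapMinus d α p) (gapPlus d α lam p) ^ (-κ)) ≤
        rieszV d α β lam p q := by
      rcases le_total (gapMinus d α p) (gapPlus d α lam p) with h | h
      · rw [min_eq_left h]
        exact ofReal_gapMinus_le_rieszV hα hβ hlam hsum hG hp
      · rw [min_eq_right h]
        exact ofReal_gapPlus_le_rieszV hα hβ hlam hsum hG hp
    have hm0 : 0 < min (gapMinus d α p) (gapPlus d α lam p) := lt_min hδ₁ hδ₂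
    refine le_trans (ENNReal.ofReal_le_ofReal ?_) hmin
    rw [mul_div_assoc, ← Real.div_rpow (by positivity) hX.le, Real.rpow_neg hm0.le,
      ← Real.inv_rpow hm0.le]
    gcongr
    rw [div_le_iff₀ hX, ← div_eq_inv_mul, le_div_iff₀ hm0]
    linarith
  · refine iSup₂_le fun f hf => ?_
    have hfp := hf.1 p hp
    have hne : eLpNorm f (ENNReal.ofReal p) volume ≠ 0 := by
      rw [Ne, eLpNorm_eq_zero_iff hfp.1 (by simpa using hp0)]
      exact hf.2
    rw [ENNReal.div_le_iff hne hfp.2.ne]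
    refine (eLpNorm_mono_enorm fun x => (enorm_weightedRiesz_le d α β lam f x).trans_eq
      (enorm_eq_self _).symm).trans ((hup p q hG hp f hfp).trans ?_)
    gcongr
    have hterm : ∀ δ, min (gapMinus d α p) (gapPlus d α lam p) ≤ δ → 0 < δ →
        (κ / δ) ^ κ ≤ W / X ^ κ := by
      intro δ hδ hδ0
      rw [hW, ← Real.div_rpow (by positivity) hX.le]
      refine Real.rpow_le_rpow (by positivity) ?_ hκ0.le
      rw [div_le_div_iff₀ hδ0 hX, mul_assoc, mul_comm (lam / d * _)]
      refine mul_le_mul_of_nonneg_left (hupp.trans ?_) hκ0.le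
      gcongr
    calc C * (ENNReal.ofReal ((κ / gapMinus d α p) ^ κ) +
          ENNReal.ofReal ((κ / gapPlus d α lam p) ^ κ))
        ≤ C * (ENNReal.ofReal (W / X ^ κ) + ENNReal.ofReal (W / X ^ κ)) := by
          gcongr
          · exact hterm _ (min_le_left _ _) hδ₁
          · exact hterm _ (min_le_right _ _) hδ₂
      _ ≤ ENNReal.ofReal (C.toReal + 1) *
            (ENNReal.ofReal (W / X ^ κ) + ENNReal.ofReal (W / X ^ κ)) := by
          gcongr
          rw [← ENNReal.ofReal_toReal hC]
          exact ENNReal.ofReal_le_ofReal (by simp)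
      _ = _ := by
          rw [← ENNReal.ofReal_add (by positivity) (by positivity),
            ← ENNReal.ofReal_mul (by positivity)]
          congr 1
          ring
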